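/- Let $M$ be a closed (compact, boundaryless) smooth surface, $a<b$ real numbers, $\mathcal M=(a,b)\times M$, $\overline{\mathcal M}=[a,b]\times M$ and $M_1=\{b\}\times M$. Let $x^0$ be the coordinate on $[a,b]$, $(x^1,x^2)$ local coordinates on $M$ and $\partial_0,\partial_1,\partial_2$ the coordinate vector fields. Let $G$ be a Riemannian metric on $\overline{\mathcal M}$, smooth up to the boundary, of the form $G=dx^0\otimes dx^0+g_{x^0}$ with a smooth family of metrics $(g_t)_{t\in[a,b]}$ on $M$ (for instance a product metric, or the metric of a spherical shell in $\mathbb R^3$). Denote by $D$, $\operatorname{div}$, $\operatorname{grad}$, $\operatorname{Ric}$ the Levi-Civita connection, divergence, gradient and Ricci tensor of $G$, and write $C(Du\otimes Du)=(Du)^i_j(Du)^j_i$. Let $\gamma>1$, $k_0,c_\nu>0$. Let the body force $\mathbf b$ (a vector field) and the heat supply $r$ (a function) be of class $C^1(\mathcal M)\cap C^0(\overline{\mathcal M})$. Let $p\in C^2(\mathcal M)\cap C^1(\overline{\mathcal M})$, let $\rho$ (a function) and $u$ (a vector field) be of class $C^1(\overline{\mathcal M})$, and suppose $\rho>0$ and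 $u^0=G(u,\partial_0)\neq0$ on $\overline{\mathcal M}$. Let $s$ be the entropy, i.e. $p=A(s)\rho^\gamma$ on $\overline{\mathcal M}$ with $A(s)=k_0e^{s/c_\nu}$, and put $c^2=\gamma p/\rho$, $E=\tfrac12G(u,u)+\tfrac{c^2}{\gamma-1}$. Set \begin{align*} R_A&=D_uA(s)-\tfrac{\gamma-1}{\rho^{\gamma-1}}r, & R_E&=D_uE-G(\mathbf b,u)-r,\\ R_m&=\tfrac{D_up}{\gamma p}+\operatorname{div}u-\tfrac{\gamma-1}{c^2}r, & R_u&=D_uu+\tfrac{\operatorname{grad}p}{\rho}-\mathbf b . \end{align*} Let $L^0,L^1,L^2,L^3$ and $L_1,L_2,L_3$ be real-valued functions which may depend on the point $x\in\overline{\mathcal M}$: $L^0(x,\cdot)$ is a linear function on $\mathbb R$, continuous in $x\in\overline{\mathcal M}$; $L^1(x,\cdot),L^2(x,\cdot),L_1(x,\cdot),L_2(x,\cdot)$ are functions on $\mathbb R$ and $L^3(x,\cdot),L_3(x,\cdot)$ functions on $T_x\overline{\mathcal M}$, arbitrary except that $L^k(x,0)=0$ and $L_k(x,0)=0$ for $k=1,2,3$.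 Then $(p,\rho,u)$ solves the steady full Euler system \[ \operatorname{div}(\rho u\otimes u)+\operatorname{grad}p-\rho \mathbf b=0,\qquad \operatorname{div}(\rho u)=0,\qquad \operatorname{div}(\rho Eu)-\rho G(\mathbf b,u)-\rho r=0\qquad\text{in }\mathcal M \] if and only if \[ R_A=0,\qquad R_E=0,\qquad G(R_u,\partial_\alpha)=0\quad(\alpha=1,2)\qquad\text{in }\mathcal M, \] \begin{multline*} D_u\Big(\frac{D_up}{\gamma p}\Big)-\operatorname{div}\Big(\frac{\operatorname{grad}p}{\rho}\Big)-C(Du\otimes Du)-\operatorname{Ric}(u,u)-(\gamma-1)D_u\Big(\frac r{c^2}\Big)+\operatorname{div}\mathbf b\\ +L^0(R_m)+L^1(R_E)+L^2(R_A)+L^3(R_u)=0\qquad\text{in }\mathcal M, \end{multline*} and \[ R_m+L_1(R_E)+L_2(R_A)+L_3(R_u)=0\qquad\text{on }M_1 . \] -/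

import Mathlib

open Set Bundle
open scoped Manifold ContDiff Topology TensorProduct

noncomputable section

namespace EulerSlab

/-- Coordinate space `ℝ × ℝ²` of the three-dimensional manifold `ℝ × M`. -/
abbrev EX : Type := ℝ × EuclideanSpace ℝ (Fin 2)

/-- The smooth model of `ℝ × M`, for a surface `M`. -/
abbrev IX : ModelWithCorners ℝ EX (ModelProd ℝ (EuclideanSpace ℝ (Fin 2))) :=
  𝓘(ℝ, ℝ).prod (𝓡 2)

/-- The standard basis of the coordinate space. -/
def basisVec : Fin 3 → EX :=
  ![(1, 0), (0, EuclideanSpace.single 0 1), (0, EuclideanSpace.single 1 1)]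

/-- The `i`-th coordinate on the coordinate space. -/
def coordFun : Fin 3 → EX →L[ℝ] ℝ :=
  ![ContinuousLinearMap.fst ℝ ℝ (EuclideanSpace ℝ (Fin 2)),
    (EuclideanSpace.proj 0 : EuclideanSpace ℝ (Fin 2) →L[ℝ] ℝ) ∘L
      ContinuousLinearMap.snd ℝ ℝ (EuclideanSpace ℝ (Fin 2)),
    (EuclideanSpace.proj 1 : EuclideanSpace ℝ (Fin 2) →L[ℝ] ℝ) ∘L
      ContinuousLinearMap.snd ℝ ℝ (EuclideanSpace ℝ (Fin 2))]

/-- The closed slab `[a, b] × M`. -/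
def slab (a b : ℝ) (M : Type*) : Set (ℝ × M) := Icc a b ×ˢ univ

/-- The open slab `(a, b) × M`. -/
def openSlab (a b : ℝ) (M : Type*) : Set (ℝ × M) := Ioo a b ×ˢ univ

section

variable {M : Type*} [TopologicalSpace M] [ChartedSpace (EuclideanSpace ℝ (Fin 2)) M]

/-- The coordinate vector `∂_i` at `z`, `i = 0, 1, 2`, of the preferred coordinates
`(x⁰, x¹, x²)` around `z`: here `x⁰` is the coordinate of the interval and `(x¹, x²)` is the
preferred chart of `M`. (In Mathlib the tangent space at `z` is identified with the coordinate
space through the preferred chart at `z`.) -/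
def pd (z : ℝ × M) (i : Fin 3) : TangentSpace IX z := basisVec i

/-- The `i`-th component of a tangent vector at `z` with respect to `∂₀, ∂₁, ∂₂`. -/
def comp (z : ℝ × M) (i : Fin 3) : TangentSpace IX z →L[ℝ] ℝ := coordFun i

/-- A scalar field on `ℝ × M`; only its values on `[a, b] × M` matter. -/
abbrev ScalarField (M : Type*) : Type _ := ℝ × M → ℝ

/-- A vector field on `ℝ × M`; only its values on `[a, b] × M` matter. -/
abbrev VField (M : Type*) [TopologicalSpace M] [ChartedSpace (EuclideanSpace ℝ (Fin 2)) M] :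
    Type _ :=
  (z : ℝ × M) → TangentSpace IX z

/-- A contravariant tensor field of rank two on `ℝ × M`. -/
abbrev TField (M : Type*) [TopologicalSpace M] [ChartedSpace (EuclideanSpace ℝ (Fin 2)) M] :
    Type _ :=
  (z : ℝ × M) → TangentSpace IX z ⊗[ℝ] TangentSpace IX z

/-- The vector field as a map into the tangent bundle. -/
def VField.toBundle (u : VField M) (z : ℝ × M) : TangentBundle IX (ℝ × M) := ⟨z, u z⟩

/-- A Riemannian metric on `[a, b] × M`, smooth up to the boundary, for which `∂₀` is a unit field
orthogonal to the slices `{t} × M`; that is, `G = dx⁰ ⊗ dx⁰ + g_{x⁰}` for a smooth family of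
metrics `g_t` on `M`. This covers the metric product, and the warped products such as a spherical
shell in `ℝ³`. -/
structure SlabMetric (a b : ℝ) (M : Type*) [TopologicalSpace M]
    [ChartedSpace (EuclideanSpace ℝ (Fin 2)) M] [IsManifold (𝓡 2) ∞ M] where
  /-- the metric tensor -/
  inner : (z : ℝ × M) → TangentSpace IX z →L[ℝ] TangentSpace IX z →L[ℝ] ℝ
  symm : ∀ z ∈ slab a b M, ∀ v w : TangentSpace IX z, inner z v w = inner z w v
  pos : ∀ z ∈ slab a b M, ∀ v : TangentSpace IX z, v ≠ 0 → 0 < inner z v v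
  smooth : ContMDiffOn IX (IX.prod 𝓘(ℝ, EX →L[ℝ] EX →L[ℝ] ℝ)) ∞
    (fun z => TotalSpace.mk' (EX →L[ℝ] EX →L[ℝ] ℝ)
      (E := fun z : ℝ × M => TangentSpace IX z →L[ℝ] TangentSpace IX z →L[ℝ] ℝ) z (inner z))
    (slab a b M)
  inner_pd_zero : ∀ z ∈ slab a b M, ∀ v : TangentSpace IX z, inner z v (pd z 0) = comp z 0 v

/-- `[a, b] × M` in the preferred coordinates around `z`. -/
def coordSlab (a b : ℝ) (z : ℝ × M) : Set EX :=
  (extChartAt IX z).target ∩ (extChartAt IX z).symm ⁻¹' slab a b M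

/-- The partial derivative `∂_i f` in the preferred coordinates around `z`
(one-sided at the boundary of the slab). -/
def partialD (a b : ℝ) (z : ℝ × M) (i : Fin 3) (f : EX → ℝ) (y : EX) : ℝ :=
  fderivWithin ℝ f (coordSlab a b z) y (basisVec i)

/-- The derivative `D_u f = df(u)` of a scalar field (one-sided at the boundary of the slab). -/
def scalarD (a b : ℝ) (u : VField M) (f : ScalarField M) : ScalarField M := fun z =>
  mfderivWithin IX 𝓘(ℝ, ℝ) f (slab a b M) z (u z)

variable [IsManifold (𝓡 2) ∞ M]

/-- The coordinate vector `∂_i` at a point `x` of the preferred coordinates around `z`. -/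
def pdAround (z x : ℝ × M) (i : Fin 3) : TangentSpace IX x :=
  tangentCoordChange IX z x x (basisVec i)

/-- The `i`-th component of a tangent vector at `x` in the preferred coordinates around `z`. -/
def compAround (z x : ℝ × M) (i : Fin 3) : TangentSpace IX x →L[ℝ] ℝ :=
  coordFun i ∘L tangentCoordChange IX x z x

/-- The components `u^i` of a vector field in the preferred coordinates around `z`. -/
def vecCoord (u : VField M) (z : ℝ × M) (i : Fin 3) (y : EX) : ℝ :=
  compAround z ((extChartAt IX z).symm y) i (u ((extChartAt IX z).symm y))

/-- The components `T^{ij}` of a tensor field in the preferred coordinates around `z`. -/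
def tensorCoord (T : TField M) (z : ℝ × M) (i j : Fin 3) (y : EX) : ℝ :=
  LinearMap.mul' ℝ ℝ
    (TensorProduct.map (compAround z ((extChartAt IX z).symm y) i).toLinearMap
      (compAround z ((extChartAt IX z).symm y) j).toLinearMap (T ((extChartAt IX z).symm y)))

variable {a b : ℝ} (G : SlabMetric a b M)

/-- The matrix `G_{ij}` of the metric in the preferred coordinates around `z`. -/
def metricCoord (z : ℝ × M) (y : EX) : Matrix (Fin 3) (Fin 3) ℝ := fun i j =>
  G.inner ((extChartAt IX z).symm y) (pdAround z ((extChartAt IX z).symm y) i)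
    (pdAround z ((extChartAt IX z).symm y) j)

/-- The Christoffel symbols `Γ^k_{ij}` in the preferred coordinates around `z`. -/
def christoffel (z : ℝ × M) (k i j : Fin 3) (y : EX) : ℝ :=
  (1 / 2) * ∑ l, (metricCoord G z y)⁻¹ k l *
    (partialD a b z i (fun y' => metricCoord G z y' j l) y
      + partialD a b z j (fun y' => metricCoord G z y' i l) y
      - partialD a b z l (fun y' => metricCoord G z y' i j) y)

/-- The components `R_{ij}` of the Ricci tensor at `z`,
`R_{ij} = ∂_k Γ^k_{ij} - ∂_j Γ^k_{ik} + Γ^k_{kl} Γ^l_{ij} - Γ^k_{jl} Γ^l_{ik}`. -/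
def ricciCoord (z : ℝ × M) (i j : Fin 3) : ℝ :=
  let y := extChartAt IX z z
  ∑ k, (partialD a b z k (christoffel G z k i j) y
    - partialD a b z j (christoffel G z k i k) y
    + ∑ l, (christoffel G z k k l y * christoffel G z l i j y
      - christoffel G z k j l y * christoffel G z l i k y))

/-- `Ric(v, w)` at `z`. -/
def ricci (z : ℝ × M) (v w : TangentSpace IX z) : ℝ :=
  ∑ i, ∑ j, ricciCoord G z i j * comp z i v * comp z j w

/-- The covariant differential `Du` at `z`: `(Du)^i_j = ∂_j u^i + Γ^i_{jk} u^k`. -/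
def covDiff (u : VField M) (z : ℝ × M) : Matrix (Fin 3) (Fin 3) ℝ := fun i j =>
  let y := extChartAt IX z z
  partialD a b z j (vecCoord u z i) y + ∑ k, christoffel G z i j k y * vecCoord u z k y

/-- The covariant derivative `D_w u` of the vector field `u` with respect to `w`. -/
def covDeriv (w u : VField M) : VField M := fun z =>
  (∑ i, (∑ j, covDiff G u z i j * comp z j (w z)) • pd z i)

/-- The divergence of a vector field, `div u = (Du)^i_i`. -/
def dvg (u : VField M) : ScalarField M := fun z => ∑ i, covDiff G u z i i

/-- The contraction `(Du)^i_j (Du)^j_i` of `Du ⊗ Du`. -/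
def contractDD (u : VField M) : ScalarField M := fun z =>
  ∑ i, ∑ j, covDiff G u z i j * covDiff G u z j i

/-- The divergence of a contravariant tensor field of rank two,
`(div T)^i = ∂_j T^{ij} + Γ^i_{jk} T^{kj} + Γ^j_{jk} T^{ik}`. -/
def tensorDvg (T : TField M) : VField M := fun z =>
  let y := extChartAt IX z z
  (∑ i, (∑ j, (partialD a b z j (tensorCoord T z i j) y
    + ∑ k, (christoffel G z i j k y * tensorCoord T z k j y
      + christoffel G z j j k y * tensorCoord T z i k y))) • pd z i)

/-- The gradient of a scalar field, `(grad f)^i = G^{ij} ∂_j f`. -/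
def grad (f : ScalarField M) : VField M := fun z =>
  (∑ i, (∑ j, (metricCoord G z (extChartAt IX z z))⁻¹ i j *
    scalarD a b (fun x => pd x j) f z) • pd z i)

end

/-! ### The gas -/

/-- The function `A(s) = k₀ exp(s / c_ν)` in the constitutive relation `p = A(s) ρ^γ`. -/
def entropyA {M : Type*} (k₀ cν : ℝ) (s : ScalarField M) : ScalarField M := fun z =>
  k₀ * Real.exp (s z / cν)

/-- The square `c² = γ p / ρ` of the sonic speed. -/
def sonicSq {M : Type*} (γ : ℝ) (p ρ : ScalarField M) : ScalarField M := fun z => γ * p z / ρ z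

section

variable {M : Type*} [TopologicalSpace M] [ChartedSpace (EuclideanSpace ℝ (Fin 2)) M]
  [IsManifold (𝓡 2) ∞ M] {a b : ℝ} (G : SlabMetric a b M)

/-- The Bernoulli function `E = |u|² / 2 + c² / (γ - 1)`. -/
def bernoulli (γ : ℝ) (p ρ : ScalarField M) (u : VField M) : ScalarField M := fun z =>
  (1 / 2) * G.inner z (u z) (u z) + sonicSq γ p ρ z / (γ - 1)

/-- The steady full Euler system in `(a, b) × M` with body force `f` and heat supply `r`:
conservation of momentum, mass and energy. -/
structure SolvesEuler (γ : ℝ) (f : VField M) (r : ScalarField M)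
    (p ρ : ScalarField M) (u : VField M) : Prop where
  momentum : ∀ z ∈ openSlab a b M,
    tensorDvg G (fun x => ρ x • (u x ⊗ₜ[ℝ] u x)) z + grad G p z - ρ z • f z = 0
  mass : ∀ z ∈ openSlab a b M, dvg G (fun x => ρ x • u x) z = 0
  energy : ∀ z ∈ openSlab a b M,
    dvg G (fun x => (ρ x * bernoulli G γ p ρ u x) • u x) z
      - ρ z * G.inner z (f z) (u z) - ρ z * r z = 0

/-- `D_u A(s) - (γ - 1) r / ρ^(γ - 1)`. -/
def resEntropy (a b γ k₀ cν : ℝ) (r ρ s : ScalarField M) (u : VField M) : ScalarField M := fun z =>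
  scalarD a b u (entropyA k₀ cν s) z - (γ - 1) / ρ z ^ (γ - 1) * r z

/-- `D_u E - G(f, u) - r`. -/
def resBernoulli (γ : ℝ) (f : VField M) (r p ρ : ScalarField M) (u : VField M) :
    ScalarField M := fun z =>
  scalarD a b u (bernoulli G γ p ρ u) z - G.inner z (f z) (u z) - r z

/-- `D_u u + (grad p) / ρ - f`. -/
def resMomentum (f : VField M) (p ρ : ScalarField M) (u : VField M) : VField M := fun z =>
  covDeriv G u u z + (ρ z)⁻¹ • grad G p z - f z

/-- `D_u p / (γ p) + div u - (γ - 1) r / c²`. -/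
def resMass (γ : ℝ) (r p ρ : ScalarField M) (u : VField M) : ScalarField M := fun z =>
  scalarD a b u p z / (γ * p z) + dvg G u z - (γ - 1) / sonicSq γ p ρ z * r z

/-- The second-order expression in the pressure
`D_u (D_u p / (γ p)) - div ((grad p) / ρ) - C(Du ⊗ Du) - Ric(u, u) - (γ - 1) D_u (r / c²) + div f`,
where `C(Du ⊗ Du) = (Du)^i_j (Du)^j_i`. -/
def pressureOp (γ : ℝ) (f : VField M) (r p ρ : ScalarField M) (u : VField M) :
    ScalarField M := fun z =>
  scalarD a b u (fun x => scalarD a b u p x / (γ * p x)) z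
    - dvg G (fun x => (ρ x)⁻¹ • grad G p x) z
    - contractDD G u z - ricci G z (u z) (u z)
    - (γ - 1) * scalarD a b u (fun x => r x / sonicSq γ p ρ x) z
    + dvg G f z

/-- The decomposed system: transport equations for `A(s)` and `E`, the second-order equation for
the pressure and the tangential momentum equations in `(a, b) × M`, and the boundary condition
on `{b} × M`. `L0, L1, L2, L3` are the auxiliary functions in the pressure equation and
`K1, K2, K3` those in the boundary condition; all may depend on the point. -/
structure SolvesDecomposed (γ k₀ cν : ℝ) (f : VField M) (r : ScalarField M)
    (L0 : ℝ × M → ℝ →L[ℝ] ℝ) (L1 L2 : ℝ × M → ℝ → ℝ)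
    (L3 : (z : ℝ × M) → TangentSpace IX z → ℝ)
    (K1 K2 : ℝ × M → ℝ → ℝ) (K3 : (z : ℝ × M) → TangentSpace IX z → ℝ)
    (p ρ s : ScalarField M) (u : VField M) : Prop where
  entropy : ∀ z ∈ openSlab a b M, resEntropy a b γ k₀ cν r ρ s u z = 0
  bernoulli : ∀ z ∈ openSlab a b M, resBernoulli G γ f r p ρ u z = 0
  pressure : ∀ z ∈ openSlab a b M,
    pressureOp G γ f r p ρ u z
      + L0 z (resMass G γ r p ρ u z)
      + L1 z (resBernoulli G γ f r p ρ u z)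
      + L2 z (resEntropy a b γ k₀ cν r ρ s u z)
      + L3 z (resMomentum G f p ρ u z) = 0
  tangential : ∀ z ∈ openSlab a b M, ∀ α : Fin 2,
    G.inner z (resMomentum G f p ρ u z) (pd z α.succ) = 0
  boundary : ∀ x : M,
    resMass G γ r p ρ u (b, x)
      + K1 (b, x) (resBernoulli G γ f r p ρ u (b, x))
      + K2 (b, x) (resEntropy a b γ k₀ cν r ρ s u (b, x))
      + K3 (b, x) (resMomentum G f p ρ u (b, x)) = 0

end

end EulerSlab

end

noncomputable section

namespace EulerSlab

/-! ### Coordinates of the model space -/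

/-! The Euler system is first replaced by its residuals. With m = div(ρu), the product rules give
div(ρu⊗u) + grad p − ρb = ρ R_u + m u for the momentum balance and ρ R_E + E m for the energy
balance. The state law gives R_E = G(R_u, u) + ρ^(γ-1)/(γ-1) R_A and R_m = m/ρ + ρ^γ/(γp) R_A. These
relations are triangular with nonvanishing diagonal factors, so the Euler system means R_u = 0, R_A
= 0 and R_m = 0 (`solvesEuler_iff`).

In the decomposed system, R_A = R_E = 0 leaves G(R_u, u) = 0. Together with the tangential equations
and u^0 ≠ 0 this forces R_u = 0 (`eq_zero_of_inner`). What remains is to compare R_m = 0 with the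
pressure equation and the condition on M_1.

The link is the identity D_u div u = div(D_u u) − C(Du⊗Du) − Ric(u,u). When R_u = 0, the
acceleration D_u u equals b − grad p/ρ, so D_u R_m is exactly the second-order expression in p.
Since u is only C^1, div u is merely continuous and the identity cannot be obtained from second
derivatives of u. It holds nevertheless along streamlines, because the acceleration is C^1:
difference quotients of u transverse to a streamline have derivatives in time that converge
(`hasDerivAt_fderiv_integralCurve`, `hasDerivAt_divergence_integralCurve`, `exists_streamline`).

Hence R_m = 0 implies the pressure equation, since all arguments of the L's vanish. Conversely the
pressure equation becomes the linear transport equation D_u R_m + L^0(R_m) = 0. All residuals except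
R_m vanish on M_1 by continuity, so the boundary condition reads R_m = 0 there. As u^0 ≠ 0, a
weighted maximum principle on the compact slab gives R_m = 0 (`eq_zero_of_transport`).

The differential operators are defined at each point through that point's own preferred chart, so
even their continuity requires tensoriality. This is supplied by the transformation law of the
Christoffel symbols (`christoffelFirst_pullback`, `covRep_transition`), after which every operator
can be read in one fixed chart. -/

theorem coordFun_basisVec (i j : Fin 3) : coordFun i (basisVec j) = if i = j then 1 else 0 := by
  fin_cases i <;> fin_cases j <;> simp [coordFun, basisVec]

theorem sum_coordFun_smul_basisVec (v : EX) : ∑ i, coordFun i v • basisVec i = v := by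
  rw [Fin.sum_univ_three]
  apply Prod.ext
  · simp [coordFun, basisVec]
  · ext k
    fin_cases k <;> simp [coordFun, basisVec]

theorem coordFun_sum_smul_basisVec (c : Fin 3 → ℝ) (k : Fin 3) :
    coordFun k (∑ i, c i • basisVec i) = c k := by
  simp [map_sum, coordFun_basisVec]

theorem ext_coordFun {v w : EX} (h : ∀ i, coordFun i v = coordFun i w) : v = w := by
  rw [← sum_coordFun_smul_basisVec v, ← sum_coordFun_smul_basisVec w]
  simp only [h]

theorem map_eq_sum_coordFun {F : Type*} [NormedAddCommGroup F] [NormedSpace ℝ F]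
    (L : EX →L[ℝ] F) (v : EX) : L v = ∑ i, coordFun i v • L (basisVec i) := by
  conv_lhs => rw [← sum_coordFun_smul_basisVec v]
  simp only [map_sum, map_smul]

/-- The trace of an endomorphism of the coordinate space does not depend on the basis. -/
theorem sum_coordFun_conj (L : EX →L[ℝ] EX) (T S : EX →L[ℝ] EX) (hTS : ∀ v, T (S v) = v) :
    ∑ i, coordFun i (S (L (T (basisVec i)))) = ∑ i, coordFun i (L (basisVec i)) := by
  have h1 : ∀ i, coordFun i (S (L (T (basisVec i)))) =
      ∑ j, coordFun j (L (T (basisVec i))) * coordFun i (S (basisVec j)) := fun i => by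
    rw [map_eq_sum_coordFun S]
    simp only [map_sum, map_smul, smul_eq_mul]
  have h2 : ∀ j, coordFun j (L (basisVec j)) =
      ∑ i, coordFun j (L (T (basisVec i))) * coordFun i (S (basisVec j)) := fun j => by
    conv_lhs => rw [← hTS (basisVec j), map_eq_sum_coordFun T]
    simp only [map_sum, map_smul, smul_eq_mul]
    exact Finset.sum_congr rfl fun i _ => mul_comm _ _
  simp only [h1, h2]
  exact Finset.sum_comm

/-! ### Change of variables for the Christoffel symbols of the first kind -/

section

variable {E : Type*} [NormedAddCommGroup E] [NormedSpace ℝ E]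

/-- The Christoffel symbols of the first kind of a metric whose differential is `g'`. -/
def christoffelFirst (g' : E →L[ℝ] E →L[ℝ] E →L[ℝ] ℝ) (v w l : E) : ℝ :=
  (1 / 2) * (g' v w l + g' w v l - g' l v w)

-- Differentiating the pulled-back metric produces one term with the derivative of `g` and two with
-- the second derivative of `τ`. In the Koszul combination the symmetry of that second derivative
-- and of `g` cancels four of the six second-order terms; the remaining two are equal.
set_option synthInstance.maxHeartbeats 400000 in
theorem christoffelFirst_pullback {g h : E → E →L[ℝ] E →L[ℝ] ℝ} {τ : E → E} {y : E}
    (hg : DifferentiableAt ℝ g (τ y)) (hh : DifferentiableAt ℝ h y) (hτ : ContDiffAt ℝ 2 τ y)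
    (hsymm : ∀ v w, g (τ y) v w = g (τ y) w v)
    (hgh : ∀ᶠ x in 𝓝 y, ∀ v w, h x v w = g (τ x) (fderiv ℝ τ x v) (fderiv ℝ τ x w)) (v w l : E) :
    christoffelFirst (fderiv ℝ h y) v w l =
      christoffelFirst (fderiv ℝ g (τ y)) (fderiv ℝ τ y v) (fderiv ℝ τ y w) (fderiv ℝ τ y l)
        + g (τ y) (fderiv ℝ (fderiv ℝ τ) y v w) (fderiv ℝ τ y l) := by
  have hτ1 : HasFDerivAt τ (fderiv ℝ τ y) y :=
    (hτ.differentiableAt (by norm_num)).hasFDerivAt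
  have hτ2 : HasFDerivAt (fderiv ℝ τ) (fderiv ℝ (fderiv ℝ τ) y) y :=
    ((hτ.fderiv_right (m := 1) (by norm_num)).differentiableAt (by norm_num)).hasFDerivAt
  have hcomm : ∀ a b, fderiv ℝ (fderiv ℝ τ) y a b = fderiv ℝ (fderiv ℝ τ) y b a :=
    fun a b => hτ.isSymmSndFDerivAt (by simp) a b
  have key : ∀ e a b, fderiv ℝ h y e a b =
      fderiv ℝ g (τ y) (fderiv ℝ τ y e) (fderiv ℝ τ y a) (fderiv ℝ τ y b)
        + g (τ y) (fderiv ℝ (fderiv ℝ τ) y e a) (fderiv ℝ τ y b)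
        + g (τ y) (fderiv ℝ τ y a) (fderiv ℝ (fderiv ℝ τ) y e b) := by
    intro e a b
    have h1 : HasFDerivAt (fun x => h x a b) _ y :=
      ((hh.hasFDerivAt.clm_apply (hasFDerivAt_const a y)).clm_apply (hasFDerivAt_const b y))
    have hgτ : HasFDerivAt (fun x => g (τ x)) ((fderiv ℝ g (τ y)).comp (fderiv ℝ τ y)) y :=
      HasFDerivAt.comp (G := E →L[ℝ] E →L[ℝ] ℝ) (g := g) (g' := fderiv ℝ g (τ y)) y
        hg.hasFDerivAt hτ1
    have h2 : HasFDerivAt (fun x => g (τ x) (fderiv ℝ τ x a) (fderiv ℝ τ x b)) _ y :=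
      (hgτ.clm_apply (hτ2.clm_apply (hasFDerivAt_const a y))).clm_apply
        (hτ2.clm_apply (hasFDerivAt_const b y))
    have h3 : (fun x => h x a b) =ᶠ[𝓝 y] fun x => g (τ x) (fderiv ℝ τ x a) (fderiv ℝ τ x b) :=
      hgh.mono fun x hx => hx a b
    have h4 := DFunLike.congr_fun (h1.unique (h2.congr_of_eventuallyEq h3)) e
    simp at h4
    linarith
  simp only [christoffelFirst, key]
  rw [hcomm l v, hcomm l w, hcomm w v, hsymm (fderiv ℝ τ y v), hsymm (fderiv ℝ τ y w)]
  ring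

/-! ### Differentiability of the differential of a field along its integral curves -/

/-- If `U` is of class `C¹` and its acceleration `DU(U)` is strictly differentiable, then `DU` is
differentiable along the integral curves of `U`. -/
theorem hasDerivAt_fderiv_integralCurve {U A : E → E} {A' : E →L[ℝ] E} {X : ℝ → E}
    (hU : ContDiffAt ℝ 1 U (X 0)) (hA : HasStrictFDerivAt A A' (X 0))
    (hAU : ∀ᶠ x in 𝓝 (X 0), A x = fderiv ℝ U x (U x))
    (hX : ∀ᶠ t in 𝓝 (0 : ℝ), HasDerivAt X (U (X t)) t) (e : E) :
    HasDerivAt (fun t => fderiv ℝ U (X t) e)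
      (A' e - fderiv ℝ U (X 0) (fderiv ℝ U (X 0) e)) 0 := by
  have hXc : ContinuousAt X 0 := hX.self_of_nhds.continuousAt
  have hUd : ∀ᶠ x in 𝓝 (X 0), DifferentiableAt ℝ U x :=
    (hU.eventually (by simp)).mono fun x hx => hx.differentiableAt (by norm_num)
  have hUs : HasStrictFDerivAt U (fderiv ℝ U (X 0)) (X 0) := hU.hasStrictFDerivAt (by norm_num)
  have hU'c : ContinuousAt (fderiv ℝ U) (X 0) :=
    (hU.fderiv_right (m := 0) (by norm_num)).continuousAt
  have hshift : Filter.Tendsto (fun q : ℝ × ℝ => X q.2 + q.1 • e)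
      (𝓝[≠] 0 ×ˢ 𝓝 0) (𝓝 (X 0)) := by
    have : Filter.Tendsto (fun q : ℝ × ℝ => X q.2 + q.1 • e) (𝓝 0 ×ˢ 𝓝 0) (𝓝 (X 0 + (0 : ℝ) • e)) :=
      (hXc.tendsto.comp Filter.tendsto_snd).add (Filter.tendsto_fst.smul_const e)
    rw [zero_smul, add_zero] at this
    exact this.mono_left (Filter.prod_mono_left _ nhdsWithin_le_nhds)
  have hbase : Filter.Tendsto (fun q : ℝ × ℝ => X q.2) (𝓝[≠] 0 ×ˢ 𝓝 0) (𝓝 (X 0)) :=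
    hXc.tendsto.comp Filter.tendsto_snd
  have hne : ∀ᶠ q : ℝ × ℝ in 𝓝[≠] 0 ×ˢ 𝓝 0, q.1 ≠ 0 :=
    Filter.tendsto_fst.eventually self_mem_nhdsWithin
  -- Strict differentiability lets the base point `X t` move while the increment `h` tends to zero,
  -- so the limit is joint in `(h, t)`.
  have hquot : ∀ {V : E → E} {V' : E →L[ℝ] E}, HasStrictFDerivAt V V' (X 0) →
      Filter.Tendsto (fun q : ℝ × ℝ => q.1⁻¹ • (V (X q.2 + q.1 • e) - V (X q.2)))
        (𝓝[≠] 0 ×ˢ 𝓝 0) (𝓝 (V' e)) := by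
    intro V V' hV
    have h1 := hV.isLittleO.comp_tendsto (hshift.prodMk_nhds hbase)
    have h2 : (fun q : ℝ × ℝ => q.1⁻¹ • (V (X q.2 + q.1 • e) - V (X q.2) - V' (q.1 • e)))
        =o[𝓝[≠] 0 ×ˢ 𝓝 0] fun _ => (1 : ℝ) := by
      have h3 : (fun q : ℝ × ℝ => q.1⁻¹ • (V (X q.2 + q.1 • e) - V (X q.2) - V' (q.1 • e)))
          =o[𝓝[≠] 0 ×ˢ 𝓝 0] fun q : ℝ × ℝ => q.1⁻¹ • (q.1 • e) := by
        refine (Asymptotics.isBigO_refl (fun q : ℝ × ℝ => q.1⁻¹) _).smul_isLittleO ?_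
        simpa [Function.comp_def] using h1
      refine h3.trans_isBigO ?_
      refine Asymptotics.IsBigO.of_bound ‖e‖ (hne.mono fun q hq => ?_)
      rw [smul_smul, inv_mul_cancel₀ hq]
      simp
    have h4 := (Asymptotics.isLittleO_one_iff ℝ).1 h2
    have h5 := h4.add_const (V' e)
    rw [zero_add] at h5
    refine h5.congr' (hne.mono fun q hq => ?_)
    simp only [map_smul, smul_sub, smul_smul, inv_mul_cancel₀ hq, one_smul]
    abel
  -- This is the time derivative of the difference quotient of `U` in direction `e`. The shifted
  -- curve `X + h e` moves with velocity `U (X t)` instead of `U (X t + h e)`; correcting for that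
  -- turns `DU(U)` at the shifted point into `A` minus the second term. No second derivative of `U`
  -- occurs.
  let f' : ℝ → ℝ → E := fun h t => h⁻¹ • (A (X t + h • e) - A (X t))
    - fderiv ℝ U (X t + h • e) (h⁻¹ • (U (X t + h • e) - U (X t)))
  -- Interchange of limit and derivative at time 0. Only the germ there matters, so uniform
  -- convergence to a constant is the same as the joint limit as `(h, t)` tends to zero.
  refine hasDerivAt_of_tendstoUniformlyOnFilter (l := 𝓝[≠] (0 : ℝ))
    (f := fun h t => h⁻¹ • (U (X t + h • e) - U (X t))) (f' := f')
    (g' := fun _ => A' e - fderiv ℝ U (X 0) (fderiv ℝ U (X 0) e)) ?_ ?_ ?_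
  · rw [tendstoUniformlyOnFilter_iff_tendsto]
    have hlim : Filter.Tendsto (fun q : ℝ × ℝ => f' q.1 q.2) (𝓝[≠] 0 ×ˢ 𝓝 0)
        (𝓝 (A' e - fderiv ℝ U (X 0) (fderiv ℝ U (X 0) e))) :=
      (hquot hA).sub ((isBoundedBilinearMap_apply.continuous.tendsto _).comp
        ((hU'c.tendsto.comp hshift).prodMk_nhds (hquot hUs)))
    exact (tendsto_const_nhds.prodMk_nhds hlim).mono_right (nhds_le_uniformity _)
  · filter_upwards [hne, hshift.eventually hUd, hbase.eventually hUd, hshift.eventually hAU,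
      hbase.eventually hAU, Filter.tendsto_snd.eventually hX] with q hq h1 h2 h3 h4 h5
    have h6 : HasDerivAt (fun t => X t + q.1 • e) (U (X q.2)) q.2 := h5.add_const _
    have h7 := ((h1.hasFDerivAt.comp_hasDerivAt q.2 h6).sub
      (h2.hasFDerivAt.comp_hasDerivAt q.2 h5)).const_smul q.1⁻¹
    refine h7.congr_deriv ?_
    simp only [f', h3, h4, map_smul, map_sub, smul_sub]
    abel
  · filter_upwards [hXc.eventually hUd] with t ht
    have h1 : HasDerivAt (fun h : ℝ => X t + h • e) e 0 := by
      simpa using ((hasDerivAt_id (0 : ℝ)).smul_const e).const_add (X t)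
    have h2 : HasDerivAt (fun h : ℝ => U (X t + h • e)) (fderiv ℝ U (X t) e) 0 := by
      refine HasFDerivAt.comp_hasDerivAt (0 : ℝ) ?_ h1
      simpa using ht.hasFDerivAt
    have h3 := h2.tendsto_slope_zero
    simpa using h3

end

/-! ### The divergence of the acceleration -/

/-- Pointwise algebra behind D_u div u = div(D_u u) − C(Du⊗Du) − Ric(u,u). Here `Γ' k i j l` stands
for ∂_l Γ^k_{ij}, `D i j` for ∂_j u^i, and `A' i` for ∂_i of the i-th component of the flat
acceleration u^j ∂_j u. Symmetry in the lower indices (no torsion) is the only input. -/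
theorem ricci_trace_identity (Γ : Fin 3 → Fin 3 → Fin 3 → ℝ) (hΓ : ∀ k i j, Γ k i j = Γ k j i)
    (Γ' : Fin 3 → Fin 3 → Fin 3 → Fin 3 → ℝ) (hΓ' : ∀ k i j, Γ' k i j = Γ' k j i)
    (D : Fin 3 → Fin 3 → ℝ) (u A' : Fin 3 → ℝ) :
    ∑ i, (A' i - ∑ j, D i j * D j i +
        ∑ k, ((∑ l, u l * Γ' i i k l) * u k + Γ i i k * ∑ j, D k j * u j)) =
      ∑ i, (A' i + ∑ j, ∑ k, (Γ' i j k i * u j * u k + Γ i j k * D j i * u k + Γ i j k * u j * D k i)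
          + ∑ k, Γ i i k * (∑ j, D k j * u j + ∑ j, ∑ l, Γ k j l * u j * u l))
        - ∑ i, ∑ j, (D i j + ∑ k, Γ i j k * u k) * (D j i + ∑ k, Γ j i k * u k)
        - ∑ i, ∑ j, (∑ k, (Γ' k i j k - Γ' k i k j + ∑ l, (Γ k k l * Γ l i j - Γ k j l * Γ l i k)))
          * u i * u j := by
  simp only [Fin.sum_univ_three, hΓ _ 1 0, hΓ _ 2 0, hΓ _ 2 1, hΓ' _ 1 0, hΓ' _ 2 0, hΓ' _ 2 1]
  ring

/-- With `F` the covariant acceleration, this is the commutation of divergence and transport for a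
field that is only C^1; the curvature enters through the derivatives of `Γ`. -/
theorem hasDerivAt_divergence_integralCurve {Γ : Fin 3 → Fin 3 → Fin 3 → EX → ℝ} {U F : EX → EX}
    {X : ℝ → EX} (hΓ : ∀ k i j, ContDiffAt ℝ 1 (Γ k i j) (X 0))
    (hsymm : ∀ k i j, Γ k i j =ᶠ[𝓝 (X 0)] Γ k j i)
    (hU : ContDiffAt ℝ 1 U (X 0)) (hF : ContDiffAt ℝ 1 F (X 0))
    (hFU : ∀ᶠ x in 𝓝 (X 0), F x = fderiv ℝ U x (U x) +
      ∑ k, (∑ i, ∑ j, Γ k i j x * coordFun i (U x) * coordFun j (U x)) • basisVec k)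
    (hX : ∀ᶠ t in 𝓝 (0 : ℝ), HasDerivAt X (U (X t)) t) :
    HasDerivAt (fun t => ∑ i, (coordFun i (fderiv ℝ U (X t) (basisVec i)) +
        ∑ k, Γ i i k (X t) * coordFun k (U (X t))))
      (∑ i, (coordFun i (fderiv ℝ F (X 0) (basisVec i)) +
          ∑ k, Γ i i k (X 0) * coordFun k (F (X 0)))
        - ∑ i, ∑ j, (coordFun i (fderiv ℝ U (X 0) (basisVec j)) +
            ∑ k, Γ i j k (X 0) * coordFun k (U (X 0))) *
          (coordFun j (fderiv ℝ U (X 0) (basisVec i)) +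
            ∑ k, Γ j i k (X 0) * coordFun k (U (X 0)))
        - ∑ i, ∑ j, (∑ k, (fderiv ℝ (Γ k i j) (X 0) (basisVec k)
            - fderiv ℝ (Γ k i k) (X 0) (basisVec j)
            + ∑ l, (Γ k k l (X 0) * Γ l i j (X 0) - Γ k j l (X 0) * Γ l i k (X 0))))
          * coordFun i (U (X 0)) * coordFun j (U (X 0))) 0 := by
  set y := X 0 with hy
  let Q : Fin 3 → EX → ℝ := fun k x => ∑ i, ∑ j, Γ k i j x * coordFun i (U x) * coordFun j (U x)
  -- The flat acceleration DU(U) is a priori only continuous; written as `F` minus the quadratic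
  -- Christoffel term it is seen to be C^1.
  let A : EX → EX := fun x => F x - ∑ k, Q k x • basisVec k
  have hUi : ∀ i, ContDiffAt ℝ 1 (fun x => coordFun i (U x)) y := fun i =>
    (coordFun i).contDiff.contDiffAt.comp y hU
  have hUd : HasFDerivAt U (fderiv ℝ U y) y := (hU.differentiableAt (by norm_num)).hasFDerivAt
  have hUid : ∀ i, HasFDerivAt (fun x => coordFun i (U x)) ((coordFun i).comp (fderiv ℝ U y)) y :=
    fun i => (coordFun i).hasFDerivAt.comp y hUd
  have hΓd : ∀ k i j, HasFDerivAt (Γ k i j) (fderiv ℝ (Γ k i j) y) y :=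
    fun k i j => ((hΓ k i j).differentiableAt (by norm_num)).hasFDerivAt
  have hQ : ∀ k, ContDiffAt ℝ 1 (Q k) y := fun k =>
    ContDiffAt.sum fun i _ => ContDiffAt.sum fun j _ => ((hΓ k i j).mul (hUi i)).mul (hUi j)
  have hQ' : ∀ k e, fderiv ℝ (Q k) y e = ∑ i, ∑ j,
      (fderiv ℝ (Γ k i j) y e * coordFun i (U y) * coordFun j (U y)
        + Γ k i j y * coordFun i (fderiv ℝ U y e) * coordFun j (U y)
        + Γ k i j y * coordFun i (U y) * coordFun j (fderiv ℝ U y e)) := by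
    intro k e
    have h : HasFDerivAt (Q k) _ y := HasFDerivAt.fun_sum fun i _ => HasFDerivAt.fun_sum fun j _ =>
      ((hΓd k i j).fun_mul (hUid i)).fun_mul (hUid j)
    rw [h.fderiv]
    simp only [sum_apply, add_apply,
      smul_apply, ContinuousLinearMap.comp_apply, smul_eq_mul]
    refine Finset.sum_congr rfl fun i _ => Finset.sum_congr rfl fun j _ => ?_
    ring
  have hA : ContDiffAt ℝ 1 A y :=
    hF.sub (ContDiffAt.sum fun k _ => (hQ k).smul contDiffAt_const)
  have hA' : ∀ i e, coordFun i (fderiv ℝ A y e) = coordFun i (fderiv ℝ F y e)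
      - fderiv ℝ (Q i) y e := by
    intro i e
    have h : HasFDerivAt A _ y := (hF.differentiableAt (by norm_num)).hasFDerivAt.sub
      (HasFDerivAt.fun_sum (u := Finset.univ) fun k _ =>
        (((hQ k).differentiableAt (by norm_num)).hasFDerivAt.smul_const (basisVec k)))
    rw [h.fderiv]
    simp only [sub_apply, sum_apply,
      ContinuousLinearMap.smulRight_apply, map_sub, coordFun_sum_smul_basisVec]
  have hAU : ∀ᶠ x in 𝓝 y, A x = fderiv ℝ U x (U x) := hFU.mono fun x hx => by
    simp only [A, Q]
    rw [hx, add_sub_cancel_right]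
  have hX0 : HasDerivAt X (U y) 0 := hX.self_of_nhds
  have hDU : ∀ e, fderiv ℝ U y e = ∑ j, coordFun j e • fderiv ℝ U y (basisVec j) :=
    map_eq_sum_coordFun _
  have hDUU : ∀ k, coordFun k (fderiv ℝ U y (U y)) =
      ∑ j, coordFun k (fderiv ℝ U y (basisVec j)) * coordFun j (U y) := fun k => by
    rw [hDU (U y)]
    simp only [map_sum, map_smul, smul_eq_mul]
    exact Finset.sum_congr rfl fun j _ => mul_comm _ _
  have main : HasDerivAt (fun t => ∑ i, (coordFun i (fderiv ℝ U (X t) (basisVec i)) +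
        ∑ k, Γ i i k (X t) * coordFun k (U (X t))))
      (∑ i, (coordFun i (fderiv ℝ A y (basisVec i) - fderiv ℝ U y (fderiv ℝ U y (basisVec i)))
        + ∑ k, (fderiv ℝ (Γ i i k) y (U y) * coordFun k (U y)
          + Γ i i k y * coordFun k (fderiv ℝ U y (U y))))) 0 := by
    refine HasDerivAt.fun_sum fun i _ => HasDerivAt.add ?_ (HasDerivAt.fun_sum fun k _ => ?_)
    · exact (coordFun i).hasFDerivAt.comp_hasDerivAt 0 (hasDerivAt_fderiv_integralCurve hU
        (hA.hasStrictFDerivAt (by norm_num)) hAU hX (basisVec i))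
    · exact ((hΓd i i k).comp_hasDerivAt 0 hX0).mul ((hUid k).comp_hasDerivAt 0 hX0)
  refine main.congr_deriv ?_
  have hF0 : ∀ k, coordFun k (F y) = ∑ j, coordFun k (fderiv ℝ U y (basisVec j)) * coordFun j (U y)
      + ∑ i, ∑ j, Γ k i j y * coordFun i (U y) * coordFun j (U y) := fun k => by
    rw [hFU.self_of_nhds, map_add, coordFun_sum_smul_basisVec, hDUU]
  have hFA : ∀ i, coordFun i (fderiv ℝ F y (basisVec i)) =
      coordFun i (fderiv ℝ A y (basisVec i)) + fderiv ℝ (Q i) y (basisVec i) := fun i => by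
    rw [hA']
    ring
  have hDD : ∀ i, coordFun i (fderiv ℝ U y (fderiv ℝ U y (basisVec i))) =
      ∑ j, coordFun i (fderiv ℝ U y (basisVec j)) * coordFun j (fderiv ℝ U y (basisVec i)) :=
    fun i => by
      rw [hDU (fderiv ℝ U y (basisVec i))]
      simp only [map_sum, map_smul, smul_eq_mul]
      exact Finset.sum_congr rfl fun j _ => mul_comm _ _
  have hΓU : ∀ i k, fderiv ℝ (Γ i i k) y (U y) =
      ∑ l, coordFun l (U y) * fderiv ℝ (Γ i i k) y (basisVec l) := fun i k => by
    rw [map_eq_sum_coordFun (fderiv ℝ (Γ i i k) y) (U y)]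
    simp only [smul_eq_mul]
  simp only [hF0, hFA, hQ', map_sub, hDD, hΓU, hDUU]
  exact ricci_trace_identity (fun k i j => Γ k i j y) (fun k i j => (hsymm k i j).eq_of_nhds)
    (fun k i j l => fderiv ℝ (Γ k i j) y (basisVec l)) (fun k i j => by rw [(hsymm k i j).fderiv_eq])
    (fun i j => coordFun i (fderiv ℝ U y (basisVec j))) (fun i => coordFun i (U y))
    (fun i => coordFun i (fderiv ℝ A y (basisVec i)))

section

variable {M : Type*} [TopologicalSpace M] [ChartedSpace (EuclideanSpace ℝ (Fin 2)) M]

/-! ### The slab in coordinates -/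

theorem extChartAt_fst (z x : ℝ × M) : (extChartAt IX z x).1 = x.1 := by
  rw [extChartAt_prod, extChartAt_model_space_eq_id]
  rfl

theorem extChartAt_symm_fst (z : ℝ × M) (y : EX) : ((extChartAt IX z).symm y).1 = y.1 := by
  rw [extChartAt_prod, extChartAt_model_space_eq_id]
  rfl

theorem isOpen_target (z : ℝ × M) : IsOpen (extChartAt IX z).target :=
  isOpen_extChartAt_target z

/-- The charts of the product leave the interval coordinate unchanged. The resulting product form
makes one-sided derivatives at the boundary unique. -/
theorem coordSlab_eq (a b : ℝ) (z : ℝ × M) :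
    coordSlab a b z = Icc a b ×ˢ (extChartAt (𝓡 2) z.2).target := by
  ext y
  simp only [coordSlab, slab, mem_inter_iff, mem_preimage, mem_prod, mem_univ, and_true,
    extChartAt_symm_fst]
  rw [extChartAt_prod, extChartAt_model_space_eq_id, PartialEquiv.prod_target,
    PartialEquiv.refl_target, mem_prod]
  simp [and_comm]

/-- `(a, b) × M` in the preferred coordinates around `z`. -/
def coordOpenSlab (a b : ℝ) (z : ℝ × M) : Set EX :=
  (extChartAt IX z).target ∩ (extChartAt IX z).symm ⁻¹' openSlab a b M

variable {a b : ℝ}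

theorem openSlab_subset_slab {M : Type*} : openSlab a b M ⊆ slab a b M :=
  prod_mono Ioo_subset_Icc_self Subset.rfl

theorem isOpen_openSlab {M : Type*} [TopologicalSpace M] : IsOpen (openSlab a b M) := isOpen_Ioo.prod isOpen_univ

theorem coordOpenSlab_subset (z : ℝ × M) : coordOpenSlab a b z ⊆ coordSlab a b z :=
  inter_subset_inter_right _ (preimage_mono openSlab_subset_slab)

theorem isOpen_coordOpenSlab (z : ℝ × M) : IsOpen (coordOpenSlab a b z) :=
  (continuousOn_extChartAt_symm z).isOpen_inter_preimage (isOpen_target z) isOpen_openSlab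

theorem coordSlab_mem_nhds {z : ℝ × M} {y : EX} (hy : y ∈ coordOpenSlab a b z) :
    coordSlab a b z ∈ 𝓝 y :=
  Filter.mem_of_superset ((isOpen_coordOpenSlab z).mem_nhds hy) (coordOpenSlab_subset z)

theorem uniqueDiffOn_coordSlab (hab : a < b) (z : ℝ × M) : UniqueDiffOn ℝ (coordSlab a b z) := by
  rw [coordSlab_eq]
  exact (uniqueDiffOn_Icc hab).prod (isOpen_extChartAt_target z.2).uniqueDiffOn

theorem extChartAt_mem_coordSlab {z x : ℝ × M} (hx : x ∈ slab a b M)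
    (hxz : x ∈ (extChartAt IX z).source) : extChartAt IX z x ∈ coordSlab a b z :=
  ⟨(extChartAt IX z).map_source hxz, by rwa [mem_preimage, (extChartAt IX z).left_inv hxz]⟩

theorem extChartAt_mem_coordOpenSlab {z x : ℝ × M} (hx : x ∈ openSlab a b M)
    (hxz : x ∈ (extChartAt IX z).source) : extChartAt IX z x ∈ coordOpenSlab a b z :=
  ⟨(extChartAt IX z).map_source hxz, by rwa [mem_preimage, (extChartAt IX z).left_inv hxz]⟩

theorem fderivWithin_coordSlab {F : Type*} [NormedAddCommGroup F] [NormedSpace ℝ F] {f : EX → F}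
    {z : ℝ × M} {y : EX} (hy : y ∈ coordOpenSlab a b z) :
    fderivWithin ℝ f (coordSlab a b z) y = fderiv ℝ f y :=
  fderivWithin_of_mem_nhds (coordSlab_mem_nhds hy)

theorem partialD_eq_fderiv {f : EX → ℝ} {z : ℝ × M} {y : EX} (hy : y ∈ coordOpenSlab a b z)
    (i : Fin 3) : partialD a b z i f y = fderiv ℝ f y (basisVec i) := by
  rw [partialD, fderivWithin_coordSlab hy]

/-- The derivative of a scalar field in the preferred coordinates around the base point. -/
theorem scalarD_eq_fderivWithin {f : ScalarField M} {u : VField M} {z : ℝ × M}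
    (hf : MDifferentiableWithinAt IX 𝓘(ℝ, ℝ) f (slab a b M) z) :
    scalarD a b u f z = fderivWithin ℝ (fun y => f ((extChartAt IX z).symm y)) (coordSlab a b z)
      (extChartAt IX z z) (u z) := by
  have h : fderivWithin ℝ (writtenInExtChartAt IX 𝓘(ℝ, ℝ) z f)
      ((extChartAt IX z).symm ⁻¹' slab a b M ∩ range IX) (extChartAt IX z z) =
      fderivWithin ℝ (fun y => f ((extChartAt IX z).symm y)) (coordSlab a b z)
        (extChartAt IX z z) := by
    -- The two sets differ only away from the base point: near it every point lies in the chart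
    -- target, and the model has full range.
    apply fderivWithin_congr_set
    filter_upwards [(isOpen_target z).mem_nhds (mem_extChartAt_target z)] with y hy
    apply propext
    constructor
    · intro h
      exact ⟨hy, h.1⟩
    · intro h
      exact ⟨h.2, by simp [mfld_simps]⟩
  exact congrArg (fun L : EX →L[ℝ] ℝ => L (u z)) (hf.mfderivWithin.trans h)

theorem contDiffOn_comp_extChartAt_symm [IsManifold (𝓡 2) ∞ M] {F : Type*} [NormedAddCommGroup F]
    [NormedSpace ℝ F] {f : ℝ × M → F} {s : Set (ℝ × M)} {n : ℕ∞ω} (hn : n ≤ ∞)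
    (hf : ContMDiffOn IX 𝓘(ℝ, F) n f s) (z : ℝ × M) :
    ContDiffOn ℝ n (fun y => f ((extChartAt IX z).symm y))
      ((extChartAt IX z).target ∩ (extChartAt IX z).symm ⁻¹' s) := by
  have h1 : ContMDiffOn 𝓘(ℝ, EX) IX n (extChartAt IX z).symm (extChartAt IX z).target :=
    (contMDiffOn_extChartAt_symm (n := ∞) z).of_le hn
  exact (hf.comp (h1.mono inter_subset_left) fun y hy => hy.2).contDiffOn

theorem mdifferentiableWithinAt_of_openSlab {f : ScalarField M}
    (hf : ContMDiffOn IX 𝓘(ℝ, ℝ) 1 f (openSlab a b M)) {x : ℝ × M} (hxo : x ∈ openSlab a b M) :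
    MDifferentiableWithinAt IX 𝓘(ℝ, ℝ) f (slab a b M) x :=
  ((hf.contMDiffAt (isOpen_openSlab.mem_nhds hxo)).mdifferentiableAt
    (by norm_num)).mdifferentiableWithinAt

theorem slab_subset_closure {M : Type*} [TopologicalSpace M] (hab : a < b) : slab a b M ⊆ closure (openSlab a b M) := by
  rw [openSlab, closure_prod_eq, closure_Ioo hab.ne, closure_univ]
  exact Subset.rfl

/-- The quantity `h` is computed at each point in that point's own chart, so its continuity cannot
be read off its definition. It follows once a single expression `H` in the chart around the limit
point represents it. -/
theorem tendsto_of_chart {F : Type*} [TopologicalSpace F] {H : EX → F} {h : ℝ × M → F} {z : ℝ × M}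
    {s : Set (ℝ × M)} (hs : s ⊆ slab a b M)
    (hH : ContinuousWithinAt H (coordSlab a b z) (extChartAt IX z z))
    (hh : ∀ x ∈ s, x ∈ (extChartAt IX z).source → h x = H (extChartAt IX z x))
    (hz : h z = H (extChartAt IX z z)) :
    Filter.Tendsto h (𝓝[s] z) (𝓝 (h z)) := by
  rw [hz]
  have h1 : ∀ᶠ x in 𝓝[s] z, x ∈ s ∧ x ∈ (extChartAt IX z).source :=
    Filter.Eventually.and self_mem_nhdsWithin
      (nhdsWithin_le_nhds ((isOpen_extChartAt_source z).mem_nhds (mem_extChartAt_source z)))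
  have h2 : Filter.Tendsto (extChartAt IX z) (𝓝[s] z)
      (𝓝[coordSlab a b z] (extChartAt IX z z)) := by
    refine tendsto_nhdsWithin_iff.2
      ⟨(continuousAt_extChartAt z).tendsto.mono_left nhdsWithin_le_nhds, ?_⟩
    exact h1.mono fun x hx => extChartAt_mem_coordSlab (hs hx.1) hx.2
  exact (hH.tendsto.comp h2).congr' (h1.mono fun x hx => (hh x hx.1 hx.2).symm)

variable [IsManifold (𝓡 2) ∞ M]

/-! ### Vector fields in coordinates -/

/-- The vector field `u` in the preferred coordinates around `z`. -/
def vecRep (u : VField M) (z : ℝ × M) (y : EX) : EX :=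
  tangentCoordChange IX ((extChartAt IX z).symm y) z ((extChartAt IX z).symm y)
    (u ((extChartAt IX z).symm y))

theorem coordFun_vecRep (u : VField M) (z : ℝ × M) (i : Fin 3) (y : EX) :
    coordFun i (vecRep u z y) = vecCoord u z i y := rfl

theorem vecRep_extChartAt (u : VField M) {z x : ℝ × M} (hx : x ∈ (extChartAt IX z).source) :
    vecRep u z (extChartAt IX z x) = tangentCoordChange IX x z x (u x) := by
  rw [vecRep, (extChartAt IX z).left_inv hx]

theorem vecRep_self (u : VField M) (z : ℝ × M) : vecRep u z (extChartAt IX z z) = u z := by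
  rw [vecRep_extChartAt u (mem_extChartAt_source z)]
  exact tangentCoordChange_self (mem_extChartAt_source z)

theorem mem_baseSet_iff {z x : ℝ × M} :
    x ∈ (trivializationAt EX (TangentSpace IX) z).baseSet ↔ x ∈ (extChartAt IX z).source := by
  rw [TangentBundle.trivializationAt_baseSet, extChartAt_source]

theorem contDiffOn_vecRep {u : VField M} {s : Set (ℝ × M)} {n : ℕ∞ω} (hn : n ≤ ∞)
    [ContMDiffVectorBundle n EX (TangentSpace IX : ℝ × M → Type _) IX]
    (hu : ContMDiffOn IX IX.tangent n u.toBundle s) (z : ℝ × M) :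
    ContDiffOn ℝ n (vecRep u z)
      ((extChartAt IX z).target ∩ (extChartAt IX z).symm ⁻¹' s) := by
  have h1 : ContMDiffOn IX 𝓘(ℝ, EX) n (fun x => tangentCoordChange IX x z x (u x))
      (s ∩ (extChartAt IX z).source) := by
    intro x hx
    exact ((trivializationAt EX (TangentSpace IX) z).contMDiffWithinAt_section _
      (mem_baseSet_iff.2 hx.2)).1 (hu.mono inter_subset_left x hx)
  refine (contDiffOn_comp_extChartAt_symm hn h1 z).mono fun y hy => ⟨hy.1, hy.2, ?_⟩
  exact (extChartAt IX z).map_target hy.1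

theorem contMDiffOn_pdAround (z : ℝ × M) (i : Fin 3) :
    ContMDiffOn IX IX.tangent ∞ (VField.toBundle fun x => pdAround z x i)
      (extChartAt IX z).source := by
  intro x hx
  refine ((trivializationAt EX (TangentSpace IX) z).contMDiffWithinAt_section _
      (mem_baseSet_iff.2 hx)).2 ?_
  refine (contMDiffOn_const (c := basisVec i) (s := (extChartAt IX z).source)).congr
    (fun x hx => ?_) x hx
  change tangentCoordChange IX x z x (tangentCoordChange IX z x x (basisVec i)) = _
  rw [tangentCoordChange_comp ⟨⟨hx, mem_extChartAt_source x⟩, hx⟩, tangentCoordChange_self hx]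

variable (G : SlabMetric a b M)

theorem contMDiffOn_inner_section {n : ℕ∞ω} (hn : n ≤ ∞)
    [ContMDiffVectorBundle n EX (TangentSpace IX : ℝ × M → Type _) IX] {u v : VField M}
    {s : Set (ℝ × M)} (hs : s ⊆ slab a b M)
    (hu : ContMDiffOn IX IX.tangent n u.toBundle s)
    (hv : ContMDiffOn IX IX.tangent n v.toBundle s) :
    ContMDiffOn IX 𝓘(ℝ, ℝ) n (fun x => G.inner x (u x) (v x)) s := by
  intro x hx
  have : ContMDiffWithinAt IX (IX.prod 𝓘(ℝ)) n
      (fun m ↦ TotalSpace.mk' ℝ (E := Bundle.Trivial (ℝ × M) ℝ) m (G.inner m (u m) (v m))) s x := by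
    apply ContMDiffWithinAt.clm_bundle_apply₂ (F₁ := EX) (F₂ := EX)
    · exact (G.smooth.mono hs x hx).of_le hn
    · exact hu x hx
    · exact hv x hx
  simp only [contMDiffWithinAt_totalSpace] at this
  exact this.2

theorem contDiffOn_metricCoord (z : ℝ × M) (i j : Fin 3) :
    ContDiffOn ℝ ∞ (fun y => metricCoord G z y i j) (coordSlab a b z) := by
  have h := contMDiffOn_inner_section G le_rfl (s := slab a b M ∩ (extChartAt IX z).source)
    inter_subset_left ((contMDiffOn_pdAround z i).mono inter_subset_right)
    ((contMDiffOn_pdAround z j).mono inter_subset_right)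
  refine (contDiffOn_comp_extChartAt_symm le_rfl h z).mono fun y hy => ⟨hy.1, hy.2, ?_⟩
  exact (extChartAt IX z).map_target hy.1

/-! ### The metric and the Christoffel symbols in coordinates -/

/-- The metric in the preferred coordinates around `z`, as a bilinear form. -/
def metricForm (z : ℝ × M) (y : EX) : EX →L[ℝ] EX →L[ℝ] ℝ :=
  ∑ i, ∑ j, metricCoord G z y i j • (coordFun i).smulRight (coordFun j)

theorem metricForm_apply (z : ℝ × M) (y v w : EX) : metricForm G z y v w =
    G.inner ((extChartAt IX z).symm y)
      (tangentCoordChange IX z ((extChartAt IX z).symm y) ((extChartAt IX z).symm y) v)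
      (tangentCoordChange IX z ((extChartAt IX z).symm y) ((extChartAt IX z).symm y) w) := by
  set x := (extChartAt IX z).symm y with hx
  let B : EX →L[ℝ] EX →L[ℝ] ℝ := G.inner x
  let T : EX →L[ℝ] EX := tangentCoordChange IX z x x
  have h1 : ∀ i j, metricCoord G z y i j = B (T (basisVec i)) (T (basisVec j)) := fun i j => rfl
  change _ = B (T v) (T w)
  rw [map_eq_sum_coordFun T v, map_eq_sum_coordFun T w]
  simp only [metricForm, h1, sum_apply, smul_apply,
    ContinuousLinearMap.smulRight_apply, map_sum, map_smul, smul_eq_mul, Finset.mul_sum]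
  rw [Finset.sum_comm]
  refine Finset.sum_congr rfl fun i _ => Finset.sum_congr rfl fun j _ => ?_
  ring

theorem metricForm_basisVec (z : ℝ × M) (y : EX) (i j : Fin 3) :
    metricForm G z y (basisVec i) (basisVec j) = metricCoord G z y i j := by
  rw [metricForm_apply]
  rfl

variable {G} in
theorem metricForm_symm {z : ℝ × M} {y : EX} (hy : y ∈ coordSlab a b z) (v w : EX) :
    metricForm G z y v w = metricForm G z y w v := by
  rw [metricForm_apply, metricForm_apply]
  exact G.symm _ hy.2 _ _

variable {G} in
theorem metricForm_pos {z : ℝ × M} {y : EX} (hy : y ∈ coordSlab a b z) {v : EX} (hv : v ≠ 0) :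
    0 < metricForm G z y v v := by
  rw [metricForm_apply]
  refine G.pos _ hy.2 _ fun h => hv ?_
  have hx := (extChartAt IX z).map_target hy.1
  have h1 := tangentCoordChange_comp (I := IX) (v := v)
    ⟨⟨hx, mem_extChartAt_source ((extChartAt IX z).symm y)⟩, hx⟩
  rw [tangentCoordChange_self hx] at h1
  rw [← h1]
  exact (congrArg _ h).trans (map_zero _)

variable {G} in
-- Nondegeneracy of the metric. Identities between vectors, such as the transformation laws of
-- Christoffel symbols and gradients, are proved by pairing both sides with the metric, which
-- removes the inverse matrix.
theorem metricForm_ext {z : ℝ × M} {y : EX} (hy : y ∈ coordSlab a b z) {v w : EX}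
    (h : ∀ l, metricForm G z y v (basisVec l) = metricForm G z y w (basisVec l)) : v = w := by
  by_contra hvw
  have h1 := metricForm_pos (G := G) hy (sub_ne_zero.2 hvw)
  have h2 : metricForm G z y (v - w) (v - w) = 0 := by
    rw [map_eq_sum_coordFun (metricForm G z y (v - w)) (v - w)]
    refine Finset.sum_eq_zero fun l _ => ?_
    rw [map_sub (metricForm G z y), sub_apply, h l, sub_self, smul_zero]
  exact h1.ne' h2

variable {G} in
theorem det_metricCoord_ne_zero {z : ℝ × M} {y : EX} (hy : y ∈ coordSlab a b z) :
    (metricCoord G z y).det ≠ 0 := by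
  intro h
  obtain ⟨c, hc, hc'⟩ := Matrix.exists_vecMul_eq_zero_iff.2 h
  refine hc ?_
  have h1 : (∑ i, c i • basisVec i) = 0 := by
    refine metricForm_ext (G := G) hy fun l => ?_
    have := congrFun hc' l
    simp only [Matrix.vecMul, dotProduct, Pi.zero_apply] at this
    simp [map_sum, sum_apply, smul_apply, metricForm_basisVec, this]
  ext i
  rw [← coordFun_sum_smul_basisVec c i, h1]
  simp

variable {G} in
-- Lowering an index that has just been raised; it serves both the Christoffel symbols and the
-- gradient.
theorem metricForm_sum_inv {z : ℝ × M} {y : EX} (hy : y ∈ coordSlab a b z) (c : Fin 3 → ℝ)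
    (l : Fin 3) : metricForm G z y (∑ i, (∑ j, (metricCoord G z y)⁻¹ i j * c j) • basisVec i)
      (basisVec l) = c l := by
  have hu : IsUnit (metricCoord G z y).det := (det_metricCoord_ne_zero hy).isUnit
  have hsymm : ∀ i j, metricCoord G z y i j = metricCoord G z y j i := fun i j => by
    rw [← metricForm_basisVec, metricForm_symm hy, metricForm_basisVec]
  rw [metricForm_symm hy]
  simp only [map_sum, map_smul, metricForm_basisVec, smul_eq_mul]
  calc ∑ i, (∑ j, (metricCoord G z y)⁻¹ i j * c j) * metricCoord G z y l i
      = (metricCoord G z y).mulVec ((metricCoord G z y)⁻¹.mulVec c) l := by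
        simp only [Matrix.mulVec, dotProduct]
        exact Finset.sum_congr rfl fun i _ => mul_comm _ _
    _ = c l := by rw [Matrix.mulVec_mulVec, Matrix.mul_nonsing_inv _ hu, Matrix.one_mulVec]

theorem contDiffOn_metricForm (z : ℝ × M) :
    ContDiffOn ℝ ∞ (metricForm G z) (coordSlab a b z) := by
  refine ContDiffOn.sum fun i _ => ContDiffOn.sum fun j _ => ?_
  let K : EX →L[ℝ] EX →L[ℝ] ℝ := (coordFun i).smulRight (coordFun j)
  have hK : ContDiff ℝ ∞ (ContinuousLinearMap.toSpanSingleton ℝ K) :=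
    ContinuousLinearMap.contDiff _
  exact hK.comp_contDiffOn (contDiffOn_metricCoord G z i j)

/-- By Cramer's rule: the determinant and the adjugate are polynomials in the smooth entries. -/
theorem contDiffOn_metricCoord_inv (z : ℝ × M) (i j : Fin 3) :
    ContDiffOn ℝ ∞ (fun y => (metricCoord G z y)⁻¹ i j) (coordSlab a b z) := by
  have h := contDiffOn_metricCoord G z
  have hdet : ContDiffOn ℝ ∞ (fun y => (metricCoord G z y).det) (coordSlab a b z) := by
    simp only [Matrix.det_fin_three]
    fun_prop
  have hadj : ContDiffOn ℝ ∞ (fun y => (metricCoord G z y).adjugate i j) (coordSlab a b z) := by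
    simp only [Matrix.adjugate_fin_three]
    fin_cases i <;> fin_cases j <;> simp <;> fun_prop
  simp only [Matrix.inv_def, Matrix.smul_apply, Ring.inverse_eq_inv', smul_eq_mul]
  exact (hdet.inv fun y hy => det_metricCoord_ne_zero hy).mul hadj

variable {G} in
theorem christoffel_symm {z : ℝ × M} {y : EX} (hy : y ∈ coordSlab a b z) (k i j : Fin 3) :
    christoffel G z k i j y = christoffel G z k j i y := by
  have h : ∀ l, partialD a b z l (fun y' => metricCoord G z y' i j) y =
      partialD a b z l (fun y' => metricCoord G z y' j i) y := fun l => by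
    rw [partialD, partialD, fderivWithin_congr' (fun y' hy' => ?_) hy]
    rw [← metricForm_basisVec, metricForm_symm hy', metricForm_basisVec]
  simp only [christoffel, h]
  congr 1
  refine Finset.sum_congr rfl fun l _ => ?_
  ring

theorem continuousOn_christoffel (hab : a < b) (z : ℝ × M) (k i j : Fin 3) :
    ContinuousOn (christoffel G z k i j) (coordSlab a b z) := by
  have h : ∀ l i j, ContinuousOn (partialD a b z l (fun y' => metricCoord G z y' i j))
      (coordSlab a b z) := fun l i j =>
    ((contDiffOn_metricCoord G z i j).continuousOn_fderivWithin
      (uniqueDiffOn_coordSlab hab z) (by simp)).clm_apply continuousOn_const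
  exact continuousOn_const.mul (continuousOn_finsetSum _ fun l _ =>
    (contDiffOn_metricCoord_inv G z k l).continuousOn.mul
      (((h i j l).add (h j i l)).sub (h l i j)))

/-- C^1 regularity is needed only in the interior, where the Ricci tensor enters; at the boundary
the continuity of the symbols suffices. -/
theorem contDiffOn_christoffel (z : ℝ × M) (k i j : Fin 3) :
    ContDiffOn ℝ 1 (christoffel G z k i j) (coordOpenSlab a b z) := by
  have h : ∀ l i j, ContDiffOn ℝ 1 (partialD a b z l (fun y' => metricCoord G z y' i j))
      (coordOpenSlab a b z) := fun l i j => by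
    have h1 := ((contDiffOn_metricCoord G z i j).mono (coordOpenSlab_subset z)).fderiv_of_isOpen
      (isOpen_coordOpenSlab z) (m := 1) (by norm_cast)
    exact (h1.clm_apply contDiffOn_const).congr fun y hy => partialD_eq_fderiv hy l
  exact contDiffOn_const.mul (ContDiffOn.sum fun l _ =>
    (((contDiffOn_metricCoord_inv G z k l).mono (coordOpenSlab_subset z)).of_le (by norm_cast)).mul
      (((h i j l).add (h j i l)).sub (h l i j)))

/-- The Christoffel symbols in the preferred coordinates around `z`, as a bilinear map. -/
def christoffelMap (z : ℝ × M) (y v w : EX) : EX :=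
  ∑ k, (∑ i, ∑ j, christoffel G z k i j y * coordFun i v * coordFun j w) • basisVec k

theorem fderiv_metricForm_apply {z : ℝ × M} {y : EX} (hy : y ∈ coordOpenSlab a b z) (e v w : EX) :
    fderiv ℝ (metricForm G z) y e v w =
      ∑ l, ∑ i, ∑ j, coordFun l e * coordFun i v * coordFun j w *
        partialD a b z l (fun y' => metricCoord G z y' i j) y := by
  have h0 : DifferentiableAt ℝ (metricForm G z) y :=
    ((contDiffOn_metricForm G z).contDiffAt (coordSlab_mem_nhds hy)).differentiableAt (by simp)
  have h1 : ∀ l i j, partialD a b z l (fun y' => metricCoord G z y' i j) y =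
      fderiv ℝ (metricForm G z) y (basisVec l) (basisVec i) (basisVec j) := fun l i j => by
    rw [partialD_eq_fderiv hy]
    have h2 : HasFDerivAt (fun y' => metricForm G z y' (basisVec i) (basisVec j)) _ y :=
      (h0.hasFDerivAt.clm_apply (hasFDerivAt_const (basisVec i) y)).clm_apply
        (hasFDerivAt_const (basisVec j) y)
    simp only [metricForm_basisVec] at h2
    rw [h2.fderiv]
    simp
  simp only [h1]
  conv_lhs => rw [map_eq_sum_coordFun (fderiv ℝ (metricForm G z) y) e]
  simp only [sum_apply, smul_apply]
  refine Finset.sum_congr rfl fun l _ => ?_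
  rw [map_eq_sum_coordFun (fderiv ℝ (metricForm G z) y (basisVec l)) v]
  simp only [sum_apply, smul_apply, Finset.smul_sum]
  refine Finset.sum_congr rfl fun i _ => ?_
  rw [map_eq_sum_coordFun (fderiv ℝ (metricForm G z) y (basisVec l) (basisVec i)) w]
  simp only [smul_eq_mul, Finset.mul_sum]
  refine Finset.sum_congr rfl fun j _ => ?_
  ring

theorem christoffelMap_eq (z : ℝ × M) (y v w : EX) : christoffelMap G z y v w =
    ∑ k, (∑ l, (metricCoord G z y)⁻¹ k l * ∑ i, ∑ j, (1 / 2) * coordFun i v * coordFun j w *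
      (partialD a b z i (fun y' => metricCoord G z y' j l) y
      + partialD a b z j (fun y' => metricCoord G z y' i l) y
      - partialD a b z l (fun y' => metricCoord G z y' i j) y)) • basisVec k := by
  refine Finset.sum_congr rfl fun k _ => ?_
  congr 1
  simp only [christoffel, Fin.sum_univ_three]
  ring

/-- Koszul's formula: lowering the upper index leaves a combination of first derivatives of the
metric, free of matrix inverses and bases, to which `christoffelFirst_pullback` applies. -/
theorem metricForm_christoffelMap {z : ℝ × M} {y : EX} (hy : y ∈ coordOpenSlab a b z)
    (v w l : EX) : metricForm G z y (christoffelMap G z y v w) l =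
      christoffelFirst (fderiv ℝ (metricForm G z) y) v w l := by
  have h1 : ∀ m, metricForm G z y (christoffelMap G z y v w) (basisVec m) =
      christoffelFirst (fderiv ℝ (metricForm G z) y) v w (basisVec m) := by
    intro m
    rw [christoffelMap_eq, metricForm_sum_inv (coordOpenSlab_subset z hy)]
    simp only [christoffelFirst, fderiv_metricForm_apply G hy, coordFun_basisVec]
    simp only [mul_ite, ite_mul, mul_one, mul_zero, zero_mul, one_mul, Finset.sum_ite_eq',
      Finset.mem_univ, if_true, Finset.sum_ite_irrel, Finset.sum_const_zero]
    simp only [Fin.sum_univ_three]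
    ring
  rw [map_eq_sum_coordFun (metricForm G z y (christoffelMap G z y v w)) l]
  simp only [h1, christoffelFirst, smul_eq_mul]
  conv_rhs => rw [map_eq_sum_coordFun (fderiv ℝ (metricForm G z) y) l,
    map_eq_sum_coordFun (fderiv ℝ (metricForm G z) y v w) l,
    map_eq_sum_coordFun (fderiv ℝ (metricForm G z) y w v) l]
  simp only [sum_apply, smul_apply, smul_eq_mul, ← Finset.sum_add_distrib, ← Finset.sum_sub_distrib,
    Finset.mul_sum]
  refine Finset.sum_congr rfl fun m _ => ?_
  ring

end

section

variable {M : Type*} [TopologicalSpace M] [ChartedSpace (EuclideanSpace ℝ (Fin 2)) M]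
  {a b : ℝ}

/-! ### Change of coordinates -/

/-- The change from the preferred coordinates around `x` to those around `z`. -/
def transition (x z : ℝ × M) : EX → EX := extChartAt IX z ∘ (extChartAt IX x).symm

theorem transition_self {x z : ℝ × M} : transition x z (extChartAt IX x x) = extChartAt IX z x := by
  rw [transition, Function.comp_apply, extChartAt_to_inv]

/-- Used to compare germs: near the image of `x`, every coordinate point comes from an interior
point covered by both charts. -/
theorem eventually_chart {x z : ℝ × M} (hxo : x ∈ openSlab a b M)
    (hx : x ∈ (extChartAt IX z).source) : ∀ᶠ y in 𝓝 (extChartAt IX x x),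
      ∃ x' ∈ (extChartAt IX x).source, x' ∈ (extChartAt IX z).source ∧ x' ∈ openSlab a b M ∧
        extChartAt IX x x' = y := by
  have h1 : ∀ᶠ x' in 𝓝 x, x' ∈ (extChartAt IX z).source ∧ x' ∈ openSlab a b M :=
    ((isOpen_extChartAt_source z).eventually_mem hx).and (isOpen_openSlab.eventually_mem hxo)
  have h2 : ContinuousAt (extChartAt IX x).symm (extChartAt IX x x) :=
    continuousAt_extChartAt_symm x
  have h3 := h2.tendsto.eventually (by rw [extChartAt_to_inv]; exact h1)
  filter_upwards [h3, (isOpen_target x).mem_nhds (mem_extChartAt_target x)] with y hy hyt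
  exact ⟨_, (extChartAt IX x).map_target hyt, hy.1, hy.2, (extChartAt IX x).right_inv hyt⟩

theorem transition_extChartAt {x z x' : ℝ × M} (hx' : x' ∈ (extChartAt IX x).source) :
    transition x z (extChartAt IX x x') = extChartAt IX z x' := by
  rw [transition, Function.comp_apply, (extChartAt IX x).left_inv hx']

variable [IsManifold (𝓡 2) ∞ M]

theorem range_IX : range IX = univ := IX.range_eq_univ

theorem fderiv_transition (x z x' : ℝ × M) :
    fderiv ℝ (transition x z) (extChartAt IX x x') = tangentCoordChange IX x z x' := by
  rw [tangentCoordChange_def, range_IX, fderivWithin_univ]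
  rfl

theorem contDiffAt_transition {x z : ℝ × M} (hx : x ∈ (extChartAt IX z).source) :
    ContDiffAt ℝ ∞ (transition x z) (extChartAt IX x x) := by
  have h : extChartAt IX x x ∈ ((extChartAt IX x).symm ≫ extChartAt IX z).source := by
    rw [PartialEquiv.trans_source'', PartialEquiv.symm_symm, PartialEquiv.symm_target]
    exact mem_image_of_mem _ ⟨mem_extChartAt_source x, hx⟩
  have h1 := contDiffWithinAt_ext_coord_change (n := ∞) z x h
  rw [range_IX] at h1
  exact h1.contDiffAt Filter.univ_mem

theorem tangentCoordChange_inv {x z x' : ℝ × M} (hx' : x' ∈ (extChartAt IX x).source)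
    (hz' : x' ∈ (extChartAt IX z).source) (v : EX) :
    tangentCoordChange IX x z x' (tangentCoordChange IX z x x' v) = v := by
  rw [tangentCoordChange_comp ⟨⟨hz', hx'⟩, hz'⟩, tangentCoordChange_self hz']

theorem vecRep_transition (u : VField M) {x z x' : ℝ × M} (hx' : x' ∈ (extChartAt IX x).source)
    (hz' : x' ∈ (extChartAt IX z).source) :
    vecRep u z (extChartAt IX z x') =
      tangentCoordChange IX x z x' (vecRep u x (extChartAt IX x x')) := by
  rw [vecRep_extChartAt u hx', vecRep_extChartAt u hz']
  exact (tangentCoordChange_comp ⟨⟨mem_extChartAt_source x', hx'⟩, hz'⟩).symm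

theorem metricForm_transition (G : SlabMetric a b M) {x z x' : ℝ × M}
    (hx' : x' ∈ (extChartAt IX x).source) (hz' : x' ∈ (extChartAt IX z).source) (v w : EX) :
    metricForm G x (extChartAt IX x x') v w = metricForm G z (extChartAt IX z x')
      (tangentCoordChange IX x z x' v) (tangentCoordChange IX x z x' w) := by
  rw [metricForm_apply, metricForm_apply, (extChartAt IX x).left_inv hx',
    (extChartAt IX z).left_inv hz']
  have h : ∀ e, tangentCoordChange IX z x' x' (tangentCoordChange IX x z x' e) =
      tangentCoordChange IX x x' x' e := fun e =>
    tangentCoordChange_comp ⟨⟨hx', hz'⟩, mem_extChartAt_source x'⟩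
  rw [h, h]

theorem metricForm_self (G : SlabMetric a b M) (z : ℝ × M) (v w : TangentSpace IX z) :
    metricForm G z (extChartAt IX z z) v w = G.inner z v w := by
  have h : ∀ e : EX, tangentCoordChange IX z z z e = e := fun e =>
    tangentCoordChange_self (mem_extChartAt_source z)
  have h1 := metricForm_apply G z (extChartAt IX z z) v w
  rw [extChartAt_to_inv] at h1
  exact h1.trans (congrArg₂ (fun p q : EX => G.inner z p q) (h v) (h w))

theorem contDiffAt_vecRep {u : VField M}
    (hu : ContMDiffOn IX IX.tangent 1 u.toBundle (openSlab a b M)) {x z : ℝ × M}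
    (hxo : x ∈ openSlab a b M) (hx : x ∈ (extChartAt IX z).source) :
    ContDiffAt ℝ 1 (vecRep u z) (extChartAt IX z x) :=
  (contDiffOn_vecRep (by norm_cast) hu z).contDiffAt
    ((isOpen_coordOpenSlab z).mem_nhds (extChartAt_mem_coordOpenSlab hxo hx))

theorem contDiffAt_scalarRep {f : ScalarField M} {n : ℕ∞ω} (hn : n ≤ ∞)
    (hf : ContMDiffOn IX 𝓘(ℝ, ℝ) n f (openSlab a b M)) {x z : ℝ × M}
    (hxo : x ∈ openSlab a b M) (hx : x ∈ (extChartAt IX z).source) :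
    ContDiffAt ℝ n (fun y => f ((extChartAt IX z).symm y)) (extChartAt IX z x) :=
  (contDiffOn_comp_extChartAt_symm hn hf z).contDiffAt
    ((isOpen_coordOpenSlab z).mem_nhds (extChartAt_mem_coordOpenSlab hxo hx))

/-- The derivative of a scalar field in the preferred coordinates around a nearby point. -/
theorem scalarD_eq_fderiv {f : ScalarField M} (u : VField M)
    (hf : ContMDiffOn IX 𝓘(ℝ, ℝ) 1 f (openSlab a b M)) {x z : ℝ × M}
    (hxo : x ∈ openSlab a b M) (hx : x ∈ (extChartAt IX z).source) :
    scalarD a b u f x = fderiv ℝ (fun y => f ((extChartAt IX z).symm y)) (extChartAt IX z x)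
      (vecRep u z (extChartAt IX z x)) := by
  have hxx := mem_extChartAt_source (I := IX) x
  have hmd : MDifferentiableWithinAt IX 𝓘(ℝ, ℝ) f (slab a b M) x :=
    ((hf.contMDiffAt (isOpen_openSlab.mem_nhds hxo)).mdifferentiableAt
      (by norm_num)).mdifferentiableWithinAt
  rw [scalarD_eq_fderivWithin hmd, fderivWithin_coordSlab (extChartAt_mem_coordOpenSlab hxo hxx)]
  have h1 : (fun y => f ((extChartAt IX x).symm y)) =ᶠ[𝓝 (extChartAt IX x x)]
      (fun y => f ((extChartAt IX z).symm y)) ∘ transition x z := by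
    filter_upwards [eventually_chart hxo hx] with y hy
    obtain ⟨x', h1, h2, h3, rfl⟩ := hy
    rw [Function.comp_apply, transition_extChartAt h1, (extChartAt IX x).left_inv h1,
      (extChartAt IX z).left_inv h2]
  have h2 : DifferentiableAt ℝ (fun y => f ((extChartAt IX z).symm y))
      (transition x z (extChartAt IX x x)) := by
    rw [transition_self]
    exact (contDiffAt_scalarRep (by norm_cast) hf hxo hx).differentiableAt (by norm_num)
  rw [h1.fderiv_eq, fderiv_comp _ h2 ((contDiffAt_transition hx).differentiableAt (by simp)),
    transition_self, fderiv_transition, vecRep_extChartAt u hx]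
  rfl

/-! ### The covariant differential in coordinates -/

variable (G : SlabMetric a b M)

/-- The covariant differential of `u` in the preferred coordinates around `z`. -/
def covRep (u : VField M) (z : ℝ × M) (y : EX) : EX →L[ℝ] EX :=
  fderivWithin ℝ (vecRep u z) (coordSlab a b z) y +
    ∑ i, (coordFun i).smulRight (christoffelMap G z y (basisVec i) (vecRep u z y))

theorem covRep_apply (u : VField M) (z : ℝ × M) (y v : EX) :
    covRep G u z y v = fderivWithin ℝ (vecRep u z) (coordSlab a b z) y v +
      christoffelMap G z y v (vecRep u z y) := by
  rw [covRep, add_apply]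
  congr 1
  refine ext_coordFun fun k => ?_
  simp only [christoffelMap, sum_apply, ContinuousLinearMap.smulRight_apply]
  rw [map_sum, coordFun_sum_smul_basisVec]
  refine Finset.sum_congr rfl fun i _ => ?_
  rw [map_smul, coordFun_sum_smul_basisVec, Finset.sum_comm, smul_eq_mul, Finset.mul_sum]
  refine Finset.sum_congr rfl fun j _ => ?_
  simp only [coordFun_basisVec, mul_ite, mul_one, mul_zero, ite_mul, zero_mul, Finset.sum_ite_eq',
    Finset.mem_univ, if_true]
  ring

theorem coordFun_christoffelMap_basisVec (z : ℝ × M) (y w : EX) (i j : Fin 3) :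
    coordFun i (christoffelMap G z y (basisVec j) w) =
      ∑ k, christoffel G z i j k y * coordFun k w := by
  rw [christoffelMap, coordFun_sum_smul_basisVec, Finset.sum_comm]
  refine Finset.sum_congr rfl fun k _ => ?_
  simp [coordFun_basisVec]

theorem covDiff_eq_covRep (hab : a < b) {u : VField M} {z : ℝ × M} (hz : z ∈ slab a b M)
    (hu : DifferentiableWithinAt ℝ (vecRep u z) (coordSlab a b z) (extChartAt IX z z))
    (i j : Fin 3) :
    covDiff G u z i j = coordFun i (covRep G u z (extChartAt IX z z) (basisVec j)) := by
  rw [covRep_apply, map_add, coordFun_christoffelMap_basisVec]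
  refine congrArg (· + _) ?_
  have h := ((coordFun i).hasFDerivAt.comp_hasFDerivWithinAt _ hu.hasFDerivWithinAt).fderivWithin
    (uniqueDiffOn_coordSlab hab z _ (extChartAt_mem_coordSlab hz (mem_extChartAt_source z)))
  exact congrArg (fun L : EX →L[ℝ] ℝ => L (basisVec j)) h

/-- Tensoriality of Du. The second derivative of the transition map appears once from
differentiating the components of `u` and once, with opposite sign, from the Christoffel symbols,
and cancels. -/
theorem covRep_transition {u : VField M}
    (hu : ContMDiffOn IX IX.tangent 1 u.toBundle (openSlab a b M)) {x z : ℝ × M}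
    (hxo : x ∈ openSlab a b M) (hx : x ∈ (extChartAt IX z).source) (v : EX) :
    tangentCoordChange IX x z x (covRep G u x (extChartAt IX x x) v) =
      covRep G u z (extChartAt IX z x) (tangentCoordChange IX x z x v) := by
  have hxx := mem_extChartAt_source (I := IX) x
  have hyx := extChartAt_mem_coordOpenSlab hxo hxx
  have hyz := extChartAt_mem_coordOpenSlab hxo hx
  have hτ : ContDiffAt ℝ 2 (transition x z) (extChartAt IX x x) :=
    (contDiffAt_transition hx).of_le (by norm_cast)
  have hτ2 : HasFDerivAt (fderiv ℝ (transition x z))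
      (fderiv ℝ (fderiv ℝ (transition x z)) (extChartAt IX x x)) (extChartAt IX x x) :=
    ((hτ.fderiv_right (m := 1) (by norm_num)).differentiableAt (by norm_num)).hasFDerivAt
  have hdg : ∀ {w : ℝ × M}, x ∈ (extChartAt IX w).source →
      DifferentiableAt ℝ (metricForm G w) (extChartAt IX w x) := fun {w} hw =>
    ((contDiffOn_metricForm G w).contDiffAt (coordSlab_mem_nhds
      (extChartAt_mem_coordOpenSlab hxo hw))).differentiableAt (by simp)
  have hdu : ∀ {w : ℝ × M}, x ∈ (extChartAt IX w).source →
      HasFDerivAt (vecRep u w) (fderiv ℝ (vecRep u w) (extChartAt IX w x)) (extChartAt IX w x) :=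
    fun {w} hw => ((contDiffAt_vecRep hu hxo hw).differentiableAt (by norm_num)).hasFDerivAt
  set T := tangentCoordChange IX x z x with hT
  have hfd : fderiv ℝ (transition x z) (extChartAt IX x x) = T := fderiv_transition x z x
  have hU : fderiv ℝ (vecRep u z) (extChartAt IX z x) (T v) =
      fderiv ℝ (fderiv ℝ (transition x z)) (extChartAt IX x x) v (vecRep u x (extChartAt IX x x))
        + T (fderiv ℝ (vecRep u x) (extChartAt IX x x) v) := by
    have h1 : (fun y => vecRep u z (transition x z y)) =ᶠ[𝓝 (extChartAt IX x x)]
        fun y => fderiv ℝ (transition x z) y (vecRep u x y) := by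
      filter_upwards [eventually_chart hxo hx] with y hy
      obtain ⟨x', h1, h2, h3, rfl⟩ := hy
      rw [transition_extChartAt h1, vecRep_transition u h1 h2, fderiv_transition]
    have h2 : HasFDerivAt (fun y => vecRep u z (transition x z y))
        ((fderiv ℝ (vecRep u z) (extChartAt IX z x)).comp T) (extChartAt IX x x) := by
      refine HasFDerivAt.comp (g := vecRep u z) (f := transition x z) (extChartAt IX x x) ?_ ?_
      · rw [transition_self]
        exact hdu hx
      · rw [← hfd]
        exact (hτ.differentiableAt (by norm_num)).hasFDerivAt
    have h3 := (h2.congr_of_eventuallyEq h1.symm).unique (hτ2.clm_apply (hdu hxx))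
    have h4 := DFunLike.congr_fun h3 v
    rw [hfd] at h4
    simp only [ContinuousLinearMap.comp_apply, add_apply,
      ContinuousLinearMap.flip_apply] at h4
    rw [h4, add_comm]
  -- Transformation law of the Christoffel symbols: pair with the metric at `z`, write the test
  -- vector as an image under `T`, and apply the pullback formula for symbols of the first kind.
  have hC : ∀ w, T (christoffelMap G x (extChartAt IX x x) v w) =
      christoffelMap G z (extChartAt IX z x) (T v) (T w) +
        fderiv ℝ (fderiv ℝ (transition x z)) (extChartAt IX x x) v w := by
    intro w
    refine metricForm_ext (G := G) (coordOpenSlab_subset z hyz) fun l => ?_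
    have hl : T (tangentCoordChange IX z x x (basisVec l)) = basisVec l :=
      tangentCoordChange_inv hxx hx _
    rw [← hl, ← metricForm_transition G hxx hx, metricForm_christoffelMap G hyx, map_add,
      add_apply, metricForm_christoffelMap G hyz]
    have h := christoffelFirst_pullback (g := metricForm G z) (h := metricForm G x)
      (τ := transition x z) (y := extChartAt IX x x) (by rw [transition_self]; exact hdg hx)
      (hdg hxx) hτ (by
        rw [transition_self]
        exact metricForm_symm (coordOpenSlab_subset z hyz)) (by
        filter_upwards [eventually_chart hxo hx] with y hy
        obtain ⟨x', h1, h2, h3, rfl⟩ := hy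
        intro v w
        rw [transition_extChartAt h1, fderiv_transition]
        exact metricForm_transition G h1 h2 v w) v w
    rw [h, hfd, transition_self]
  rw [covRep_apply, covRep_apply, fderivWithin_coordSlab hyx, fderivWithin_coordSlab hyz, map_add,
    hC, hU, vecRep_transition u hxx hx]
  abel

end

section

variable {M : Type*} [TopologicalSpace M] [ChartedSpace (EuclideanSpace ℝ (Fin 2)) M]
  [IsManifold (𝓡 2) ∞ M] {a b : ℝ} (G : SlabMetric a b M)

/-! ### Divergence, covariant derivative and gradient in coordinates -/

/-- The divergence of `u` in the preferred coordinates around `z`. -/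
def divRep (u : VField M) (z : ℝ × M) (y : EX) : ℝ :=
  ∑ i, coordFun i (covRep G u z y (basisVec i))

/-- The gradient of `f` in the preferred coordinates around `z`. -/
def gradRep (f : ScalarField M) (z : ℝ × M) (y : EX) : EX :=
  ∑ i, (∑ j, (metricCoord G z y)⁻¹ i j *
    fderivWithin ℝ (fun y => f ((extChartAt IX z).symm y)) (coordSlab a b z) y (basisVec j))
      • basisVec i

theorem differentiableWithinAt_vecRep {u : VField M}
    (hu : ContMDiffOn IX IX.tangent 1 u.toBundle (slab a b M)) {z : ℝ × M} (hz : z ∈ slab a b M) :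
    DifferentiableWithinAt ℝ (vecRep u z) (coordSlab a b z) (extChartAt IX z z) :=
  ((contDiffOn_vecRep (by norm_cast) hu z).differentiableOn (by norm_num)) _
    (extChartAt_mem_coordSlab hz (mem_extChartAt_source z))

theorem differentiableWithinAt_vecRep_of_openSlab {u : VField M}
    (hu : ContMDiffOn IX IX.tangent 1 u.toBundle (openSlab a b M)) {z : ℝ × M}
    (hz : z ∈ openSlab a b M) :
    DifferentiableWithinAt ℝ (vecRep u z) (coordSlab a b z) (extChartAt IX z z) :=
  ((contDiffAt_vecRep hu hz (mem_extChartAt_source z)).differentiableAt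
    (by norm_num)).differentiableWithinAt

theorem dvg_self (hab : a < b) {u : VField M} {z : ℝ × M} (hz : z ∈ slab a b M)
    (hu : DifferentiableWithinAt ℝ (vecRep u z) (coordSlab a b z) (extChartAt IX z z)) :
    dvg G u z = divRep G u z (extChartAt IX z z) :=
  Finset.sum_congr rfl fun i _ => covDiff_eq_covRep G hab hz hu i i

/-- The covariant differentials in the two charts are conjugate endomorphisms, and the trace is
invariant under conjugation. -/
theorem dvg_eq (hab : a < b) {u : VField M}
    (hu : ContMDiffOn IX IX.tangent 1 u.toBundle (openSlab a b M)) {x z : ℝ × M}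
    (hxo : x ∈ openSlab a b M) (hx : x ∈ (extChartAt IX z).source) :
    dvg G u x = divRep G u z (extChartAt IX z x) := by
  have hxx := mem_extChartAt_source (I := IX) x
  rw [dvg_self G hab (openSlab_subset_slab hxo) (differentiableWithinAt_vecRep_of_openSlab hu hxo)]
  rw [divRep, divRep, ← sum_coordFun_conj (covRep G u z (extChartAt IX z x))
    (tangentCoordChange IX x z x) (tangentCoordChange IX z x x) (tangentCoordChange_inv hxx hx)]
  refine Finset.sum_congr rfl fun i _ => ?_
  rw [← covRep_transition G hu hxo hx, tangentCoordChange_inv hx hxx]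

theorem covDeriv_self (hab : a < b) (w : VField M) {u : VField M} {z : ℝ × M}
    (hz : z ∈ slab a b M)
    (hu : DifferentiableWithinAt ℝ (vecRep u z) (coordSlab a b z) (extChartAt IX z z)) :
    covDeriv G w u z = covRep G u z (extChartAt IX z z) (w z) := by
  refine ext_coordFun fun k => ?_
  have h1 : coordFun k (covDeriv G w u z) = ∑ j, covDiff G u z k j * coordFun j (w z) :=
    coordFun_sum_smul_basisVec (fun i => ∑ j, covDiff G u z i j * coordFun j (w z)) k
  have h2 := map_eq_sum_coordFun (covRep G u z (extChartAt IX z z)) (w z)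
  rw [h1]
  refine Eq.trans ?_ (congrArg (coordFun k) h2).symm
  rw [map_sum]
  refine Finset.sum_congr rfl fun j _ => ?_
  rw [covDiff_eq_covRep G hab hz hu, map_smul, smul_eq_mul, mul_comm]

theorem covDeriv_eq (hab : a < b) (w : VField M) {u : VField M}
    (hu : ContMDiffOn IX IX.tangent 1 u.toBundle (openSlab a b M)) {x z : ℝ × M}
    (hxo : x ∈ openSlab a b M) (hx : x ∈ (extChartAt IX z).source) :
    tangentCoordChange IX x z x (covDeriv G w u x) =
      covRep G u z (extChartAt IX z x) (vecRep w z (extChartAt IX z x)) := by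
  have h := covDeriv_self G hab w (openSlab_subset_slab hxo)
    (differentiableWithinAt_vecRep_of_openSlab hu hxo)
  rw [vecRep_extChartAt w hx]
  exact (congrArg (tangentCoordChange IX x z x) h).trans (covRep_transition G hu hxo hx (w x))

theorem grad_self {f : ScalarField M} {z : ℝ × M}
    (hf : MDifferentiableWithinAt IX 𝓘(ℝ, ℝ) f (slab a b M) z) :
    grad G f z = gradRep G f z (extChartAt IX z z) := by
  have h : ∀ j, scalarD a b (fun x => pd x j) f z =
      fderivWithin ℝ (fun y => f ((extChartAt IX z).symm y)) (coordSlab a b z)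
        (extChartAt IX z z) (basisVec j) := fun j => scalarD_eq_fderivWithin hf
  simp only [grad, h]
  rfl

theorem metricForm_gradRep {f : ScalarField M} {z : ℝ × M} {y : EX} (hy : y ∈ coordSlab a b z)
    (v : EX) : metricForm G z y (gradRep G f z y) v =
      fderivWithin ℝ (fun y => f ((extChartAt IX z).symm y)) (coordSlab a b z) y v := by
  rw [map_eq_sum_coordFun (metricForm G z y (gradRep G f z y)) v, map_eq_sum_coordFun
    (fderivWithin ℝ (fun y => f ((extChartAt IX z).symm y)) (coordSlab a b z) y) v]
  refine Finset.sum_congr rfl fun l _ => ?_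
  rw [gradRep, metricForm_sum_inv hy]

theorem inner_grad (u : VField M) {f : ScalarField M} {z : ℝ × M} (hz : z ∈ slab a b M)
    (hf : MDifferentiableWithinAt IX 𝓘(ℝ, ℝ) f (slab a b M) z) :
    G.inner z (grad G f z) (u z) = scalarD a b u f z := by
  rw [scalarD_eq_fderivWithin hf, ← metricForm_self]
  exact (congrArg (fun e => metricForm G z (extChartAt IX z z) e (u z)) (grad_self G hf)).trans
    (metricForm_gradRep G (extChartAt_mem_coordSlab hz (mem_extChartAt_source z)) (u z))

/-- The differential does not depend on the chart, and the gradient is its metric dual: both sides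
have the same pairing with each coordinate field of the chart around `z`. -/
theorem grad_eq {f : ScalarField M} (hf : ContMDiffOn IX 𝓘(ℝ, ℝ) 1 f (openSlab a b M))
    {x z : ℝ × M} (hxo : x ∈ openSlab a b M) (hx : x ∈ (extChartAt IX z).source) :
    tangentCoordChange IX x z x (grad G f x) = gradRep G f z (extChartAt IX z x) := by
  have hxx := mem_extChartAt_source (I := IX) x
  have hyz := extChartAt_mem_coordOpenSlab hxo hx
  refine metricForm_ext (G := G) (coordOpenSlab_subset z hyz) fun l => ?_
  rw [metricForm_gradRep G (coordOpenSlab_subset z hyz)]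
  have hl : tangentCoordChange IX x z x (tangentCoordChange IX z x x (basisVec l)) = basisVec l :=
    tangentCoordChange_inv hxx hx _
  have h1 : G.inner x (grad G f x) (pdAround z x l) = _ :=
    inner_grad G (fun x => pdAround z x l) (openSlab_subset_slab hxo)
      (mdifferentiableWithinAt_of_openSlab hf hxo)
  rw [scalarD_eq_fderiv _ hf hxo hx, vecRep_extChartAt _ hx, ← metricForm_self] at h1
  have h2 : tangentCoordChange IX x z x (pdAround z x l) = basisVec l := hl
  rw [fderivWithin_coordSlab hyz]
  have h3 := metricForm_transition G hxx hx (grad G f x) (pdAround z x l)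
  rw [h2] at h1
  refine Eq.trans ?_ h1
  refine Eq.trans ?_ h3.symm
  rw [h2]

end

section

variable {M : Type*} [TopologicalSpace M] [ChartedSpace (EuclideanSpace ℝ (Fin 2)) M]
  [IsManifold (𝓡 2) ∞ M] {a b : ℝ} (G : SlabMetric a b M)

/-! ### Continuity up to the boundary -/

theorem continuousOn_fderivWithin_scalarRep (hab : a < b) {f : ScalarField M}
    (hf : ContMDiffOn IX 𝓘(ℝ, ℝ) 1 f (slab a b M)) (z : ℝ × M) :
    ContinuousOn (fderivWithin ℝ (fun y => f ((extChartAt IX z).symm y)) (coordSlab a b z))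
      (coordSlab a b z) :=
  (contDiffOn_comp_extChartAt_symm (by norm_cast) hf z).continuousOn_fderivWithin
    (uniqueDiffOn_coordSlab hab z) (by norm_num)

theorem continuousOn_vecRep {u : VField M}
    (hu : ContinuousOn u.toBundle (slab a b M)) (z : ℝ × M) :
    ContinuousOn (vecRep u z) (coordSlab a b z) := by
  -- Continuous fields are treated as the case n = 0 of the smooth statement, which asks for the
  -- corresponding bundle regularity.
  have : ContMDiffVectorBundle 0 EX (TangentSpace IX : ℝ × M → Type _) IX :=
    ContMDiffVectorBundle.of_le (n := 1) (by norm_num)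
  exact (contDiffOn_vecRep (n := 0) (by norm_num) (contMDiffOn_zero_iff.2 hu) z).continuousOn

theorem continuousOn_covRep (hab : a < b) {u : VField M}
    (hu : ContMDiffOn IX IX.tangent 1 u.toBundle (slab a b M)) (z : ℝ × M) {V : EX → EX}
    (hV : ContinuousOn V (coordSlab a b z)) :
    ContinuousOn (fun y => covRep G u z y (V y)) (coordSlab a b z) := by
  simp only [covRep_apply]
  have h1 := (contDiffOn_vecRep (by norm_cast) hu z).continuousOn_fderivWithin
    (uniqueDiffOn_coordSlab hab z) (by norm_num)
  have h2 := continuousOn_vecRep hu.continuousOn z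
  refine (h1.clm_apply hV).add (continuousOn_finsetSum _ fun k _ => ContinuousOn.smul
    (continuousOn_finsetSum _ fun i _ => continuousOn_finsetSum _ fun j _ =>
      ((continuousOn_christoffel G hab z k i j).mul ?_).mul ?_) continuousOn_const)
  · exact (coordFun i).continuous.comp_continuousOn hV
  · exact (coordFun j).continuous.comp_continuousOn h2

theorem continuousOn_gradRep (hab : a < b) {f : ScalarField M}
    (hf : ContMDiffOn IX 𝓘(ℝ, ℝ) 1 f (slab a b M)) (z : ℝ × M) :
    ContinuousOn (gradRep G f z) (coordSlab a b z) :=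
  continuousOn_finsetSum _ fun i _ => ContinuousOn.smul (continuousOn_finsetSum _ fun j _ =>
    (contDiffOn_metricCoord_inv G z i j).continuousOn.mul
      ((continuousOn_fderivWithin_scalarRep hab hf z).clm_apply continuousOn_const))
    continuousOn_const

theorem tendsto_scalarD (hab : a < b) {f : ScalarField M} {u : VField M}
    (hf : ContMDiffOn IX 𝓘(ℝ, ℝ) 1 f (slab a b M)) (hu : ContinuousOn u.toBundle (slab a b M))
    {z : ℝ × M} (hz : z ∈ slab a b M) :
    Filter.Tendsto (scalarD a b u f) (𝓝[openSlab a b M] z) (𝓝 (scalarD a b u f z)) := by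
  have hzz := mem_extChartAt_source (I := IX) z
  refine tendsto_of_chart openSlab_subset_slab (H := fun y => fderivWithin ℝ (fun y => f ((extChartAt IX z).symm y))
    (coordSlab a b z) y (vecRep u z y)) ?_ (fun x hxo hx => ?_) ?_
  · exact ((continuousOn_fderivWithin_scalarRep hab hf z).clm_apply (continuousOn_vecRep hu z)) _
      (extChartAt_mem_coordSlab hz hzz)
  · rw [scalarD_eq_fderiv u (hf.mono openSlab_subset_slab) hxo hx,
      fderivWithin_coordSlab (extChartAt_mem_coordOpenSlab hxo hx)]
  · rw [scalarD_eq_fderivWithin ((hf z hz).mdifferentiableWithinAt (by norm_num)), vecRep_self]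

theorem tendsto_dvg (hab : a < b) {u : VField M}
    (hu : ContMDiffOn IX IX.tangent 1 u.toBundle (slab a b M)) {z : ℝ × M} (hz : z ∈ slab a b M) :
    Filter.Tendsto (dvg G u) (𝓝[openSlab a b M] z) (𝓝 (dvg G u z)) := by
  have hzz := mem_extChartAt_source (I := IX) z
  refine tendsto_of_chart openSlab_subset_slab (H := divRep G u z) ?_ (fun x hxo hx => ?_) ?_
  · exact (continuousOn_finsetSum _ fun i _ => (coordFun i).continuous.comp_continuousOn
      (continuousOn_covRep G hab hu z continuousOn_const)) _ (extChartAt_mem_coordSlab hz hzz)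
  · exact dvg_eq G hab (hu.mono openSlab_subset_slab) hxo hx
  · exact dvg_self G hab hz (differentiableWithinAt_vecRep hu hz)

theorem nhdsWithin_openSlab_neBot {M : Type*} [TopologicalSpace M] (hab : a < b) {z : ℝ × M} (hz : z ∈ slab a b M) :
    (𝓝[openSlab a b M] z).NeBot :=
  mem_closure_iff_nhdsWithin_neBot.1 (slab_subset_closure hab hz)

theorem eq_zero_of_tendsto {M : Type*} [TopologicalSpace M] (hab : a < b) {h : ScalarField M} {z : ℝ × M} (hz : z ∈ slab a b M)
    (hh : Filter.Tendsto h (𝓝[openSlab a b M] z) (𝓝 (h z)))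
    (h0 : ∀ x ∈ openSlab a b M, h x = 0) : h z = 0 := by
  have := nhdsWithin_openSlab_neBot hab hz
  refine tendsto_nhds_unique hh (tendsto_const_nhds.congr' ?_)
  filter_upwards [self_mem_nhdsWithin] with x hx
  rw [h0 x hx]

/-- The momentum residual in the preferred coordinates around `z`. -/
def momentumRep (f : VField M) (p ρ : ScalarField M) (u : VField M) (z : ℝ × M) (y : EX) : EX :=
  covRep G u z y (vecRep u z y) + (ρ ((extChartAt IX z).symm y))⁻¹ • gradRep G p z y - vecRep f z y

theorem resMomentum_eq (hab : a < b) {f : VField M} {p ρ : ScalarField M} {u : VField M}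
    (hp : ContMDiffOn IX 𝓘(ℝ, ℝ) 1 p (openSlab a b M))
    (hu : ContMDiffOn IX IX.tangent 1 u.toBundle (openSlab a b M))
    {x z : ℝ × M} (hxo : x ∈ openSlab a b M) (hx : x ∈ (extChartAt IX z).source) :
    tangentCoordChange IX x z x (resMomentum G f p ρ u x) =
      momentumRep G f p ρ u z (extChartAt IX z x) := by
  let T : EX →L[ℝ] EX := tangentCoordChange IX x z x
  have h : T (resMomentum G f p ρ u x) =
      T (covDeriv G u u x) + (ρ x)⁻¹ • T (grad G p x) - T (f x) := by
    have hT : ∀ (c : ℝ) (v w q : EX), T (v + c • w - q) = T v + c • T w - T q := by simp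
    exact hT _ _ _ _
  refine h.trans ?_
  rw [momentumRep, ← covDeriv_eq G hab u hu hxo hx, ← grad_eq G hp hxo hx, vecRep_extChartAt f hx,
    (extChartAt IX z).left_inv hx]

theorem resMomentum_self (hab : a < b) {f : VField M} {p ρ : ScalarField M} {u : VField M}
    (hp : ContMDiffOn IX 𝓘(ℝ, ℝ) 1 p (slab a b M))
    (hu : ContMDiffOn IX IX.tangent 1 u.toBundle (slab a b M))
    {z : ℝ × M} (hz : z ∈ slab a b M) :
    resMomentum G f p ρ u z = momentumRep G f p ρ u z (extChartAt IX z z) := by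
  rw [momentumRep, extChartAt_to_inv, vecRep_self, vecRep_self]
  have h1 := covDeriv_self G hab u hz (differentiableWithinAt_vecRep hu hz)
  have h2 := grad_self G ((hp z hz).mdifferentiableWithinAt (by norm_num))
  exact congrArg₂ (fun v w : EX => v + (ρ z)⁻¹ • w - (show EX from f z)) h1 h2

/-- The momentum equation extends to the boundary. -/
theorem resMomentum_eq_zero (hab : a < b) {f : VField M} {p ρ : ScalarField M} {u : VField M}
    (hf : ContinuousOn f.toBundle (slab a b M))
    (hp : ContMDiffOn IX 𝓘(ℝ, ℝ) 1 p (slab a b M))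
    (hρ : ContMDiffOn IX 𝓘(ℝ, ℝ) 1 ρ (slab a b M)) (hρpos : ∀ z ∈ slab a b M, 0 < ρ z)
    (hu : ContMDiffOn IX IX.tangent 1 u.toBundle (slab a b M))
    (h0 : ∀ x ∈ openSlab a b M, resMomentum G f p ρ u x = 0)
    {z : ℝ × M} (hz : z ∈ slab a b M) : resMomentum G f p ρ u z = 0 := by
  have hzz := mem_extChartAt_source (I := IX) z
  -- Values at different points lie in different tangent spaces; the limit is taken after reading
  -- all of them in the chart around `z`.
  let h : ℝ × M → EX := fun x => tangentCoordChange IX x z x (resMomentum G f p ρ u x)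
  have hself : h z = resMomentum G f p ρ u z := tangentCoordChange_self hzz
  have ht : Filter.Tendsto h (𝓝[openSlab a b M] z) (𝓝 (h z)) := by
    refine tendsto_of_chart openSlab_subset_slab (H := momentumRep G f p ρ u z) ?_ (fun x hxo hx => ?_) ?_
    · refine ContinuousOn.continuousWithinAt (s := coordSlab a b z) ?_
        (extChartAt_mem_coordSlab hz hzz)
      refine ((continuousOn_covRep G hab hu z (continuousOn_vecRep hu.continuousOn z)).add
        (ContinuousOn.smul (ContinuousOn.inv₀ ?_ fun y hy => (hρpos _ hy.2).ne')
          (continuousOn_gradRep G hab hp z))).sub (continuousOn_vecRep hf z)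
      exact (contDiffOn_comp_extChartAt_symm (by norm_cast) hρ z).continuousOn
    · exact resMomentum_eq G hab (hp.mono openSlab_subset_slab) (hu.mono openSlab_subset_slab)
        hxo hx
    · rw [hself]
      exact resMomentum_self G hab hp hu hz
  have := nhdsWithin_openSlab_neBot hab hz
  refine hself.symm.trans (?_ : h z = (0 : EX))
  refine tendsto_nhds_unique ht (tendsto_const_nhds.congr' ?_)
  filter_upwards [self_mem_nhdsWithin] with x hx
  exact ((congrArg (tangentCoordChange IX x z x) (h0 x hx)).trans (map_zero _)).symm

end

section

variable {M : Type*} [TopologicalSpace M] [ChartedSpace (EuclideanSpace ℝ (Fin 2)) M]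
  [IsManifold (𝓡 2) ∞ M] {a b : ℝ} (G : SlabMetric a b M)

/-! ### Product rules -/

theorem vecRep_smul (h : ScalarField M) (u : VField M) (z : ℝ × M) (y : EX) :
    vecRep (fun x => h x • u x) z y = h ((extChartAt IX z).symm y) • vecRep u z y :=
  map_smul (tangentCoordChange IX ((extChartAt IX z).symm y) z ((extChartAt IX z).symm y))
    (h ((extChartAt IX z).symm y)) (show EX from u ((extChartAt IX z).symm y))

theorem vecRep_sub (u v : VField M) (z : ℝ × M) (y : EX) :
    vecRep (fun x => u x - v x) z y = vecRep u z y - vecRep v z y :=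
  map_sub (tangentCoordChange IX ((extChartAt IX z).symm y) z ((extChartAt IX z).symm y))
    (show EX from u ((extChartAt IX z).symm y)) (show EX from v ((extChartAt IX z).symm y))

theorem divRep_eq {u : VField M} {z : ℝ × M} {y : EX} (hy : y ∈ coordOpenSlab a b z) :
    divRep G u z y = ∑ i, (coordFun i (fderiv ℝ (vecRep u z) y (basisVec i)) +
      ∑ k, christoffel G z i i k y * coordFun k (vecRep u z y)) := by
  refine Finset.sum_congr rfl fun i _ => ?_
  rw [covRep_apply, map_add, coordFun_christoffelMap_basisVec, fderivWithin_coordSlab hy]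

theorem dvg_smul (hab : a < b) {h : ScalarField M} {u : VField M}
    (hh : ContMDiffOn IX 𝓘(ℝ, ℝ) 1 h (openSlab a b M))
    (hu : ContMDiffOn IX IX.tangent 1 u.toBundle (openSlab a b M)) {z : ℝ × M}
    (hz : z ∈ openSlab a b M) :
    dvg G (fun x => h x • u x) z = h z * dvg G u z + scalarD a b u h z := by
  have hzz := mem_extChartAt_source (I := IX) z
  have hy := extChartAt_mem_coordOpenSlab hz hzz
  have hU := (contDiffAt_vecRep hu hz hzz).differentiableAt (by norm_num)
  have hH := (contDiffAt_scalarRep (by norm_cast) hh hz hzz).differentiableAt (by norm_num)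
  have hrep : vecRep (fun x => h x • u x) z =
      fun y => h ((extChartAt IX z).symm y) • vecRep u z y := funext fun y => vecRep_smul h u z y
  have hd := hH.hasFDerivAt.fun_smul hU.hasFDerivAt
  rw [dvg_self G hab (openSlab_subset_slab hz) (by
      rw [hrep]; exact hd.differentiableAt.differentiableWithinAt),
    dvg_self G hab (openSlab_subset_slab hz) hU.differentiableWithinAt, divRep_eq G hy,
    divRep_eq G hy, scalarD_eq_fderiv u hh hz hzz, hrep, hd.fderiv, map_eq_sum_coordFun
      (fderiv ℝ (fun y => h ((extChartAt IX z).symm y)) (extChartAt IX z z)), extChartAt_to_inv,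
    Finset.mul_sum, ← Finset.sum_add_distrib]
  refine Finset.sum_congr rfl fun i _ => ?_
  simp only [add_apply, smul_apply, ContinuousLinearMap.smulRight_apply, map_add, map_smul,
    smul_eq_mul, mul_add, Finset.mul_sum]
  rw [add_right_comm]
  refine congrArg₂ _ (congrArg₂ _ rfl (Finset.sum_congr rfl fun k _ => ?_)) (mul_comm _ _)
  rw [extChartAt_to_inv]
  ring

theorem dvg_sub (hab : a < b) {u v : VField M} {z : ℝ × M} (hz : z ∈ openSlab a b M)
    (hu : DifferentiableAt ℝ (vecRep u z) (extChartAt IX z z))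
    (hv : DifferentiableAt ℝ (vecRep v z) (extChartAt IX z z)) :
    dvg G (fun x => u x - v x) z = dvg G u z - dvg G v z := by
  have hy := extChartAt_mem_coordOpenSlab hz (mem_extChartAt_source (I := IX) z)
  have hrep : vecRep (fun x => u x - v x) z = fun y => vecRep u z y - vecRep v z y :=
    funext fun y => vecRep_sub u v z y
  have hd := hu.hasFDerivAt.fun_sub hv.hasFDerivAt
  rw [dvg_self G hab (openSlab_subset_slab hz) (by
      rw [hrep]; exact hd.differentiableAt.differentiableWithinAt),
    dvg_self G hab (openSlab_subset_slab hz) hu.differentiableWithinAt,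
    dvg_self G hab (openSlab_subset_slab hz) hv.differentiableWithinAt, divRep_eq G hy,
    divRep_eq G hy, divRep_eq G hy, hrep, hd.fderiv, ← Finset.sum_sub_distrib]
  refine Finset.sum_congr rfl fun i _ => ?_
  simp only [sub_apply, map_sub, mul_sub, Finset.sum_sub_distrib]
  ring

theorem tensorCoord_smul_tmul (ρ : ScalarField M) (u : VField M) (z : ℝ × M) (i j : Fin 3)
    (y : EX) : tensorCoord (fun x => ρ x • (u x ⊗ₜ[ℝ] u x)) z i j y =
      ρ ((extChartAt IX z).symm y) * (vecCoord u z i y * vecCoord u z j y) := by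
  simp only [tensorCoord, map_smul, TensorProduct.map_tmul, LinearMap.mul'_apply, smul_eq_mul]
  rfl

/-- The divergence of the momentum flux. -/
theorem tensorDvg_smul_tmul (hab : a < b) {ρ : ScalarField M} {u : VField M}
    (hρ : ContMDiffOn IX 𝓘(ℝ, ℝ) 1 ρ (openSlab a b M))
    (hu : ContMDiffOn IX IX.tangent 1 u.toBundle (openSlab a b M)) {z : ℝ × M}
    (hz : z ∈ openSlab a b M) :
    tensorDvg G (fun x => ρ x • (u x ⊗ₜ[ℝ] u x)) z =
      ρ z • covDeriv G u u z + dvg G (fun x => ρ x • u x) z • u z := by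
  have hzz := mem_extChartAt_source (I := IX) z
  have hy := extChartAt_mem_coordOpenSlab hz hzz
  have hU := (contDiffAt_vecRep hu hz hzz).differentiableAt (by norm_num)
  have hR := (contDiffAt_scalarRep (by norm_cast) hρ hz hzz).differentiableAt (by norm_num)
  have hUi : ∀ i, DifferentiableAt ℝ (vecCoord u z i) (extChartAt IX z z) := fun i =>
    (coordFun i).differentiableAt.comp _ hU
  have hcomp : ∀ i, coordFun i (u z) = vecCoord u z i (extChartAt IX z z) := fun i => by
    rw [← coordFun_vecRep, vecRep_self]
  have hprod : ∀ i j, partialD a b z j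
      (tensorCoord (fun x => ρ x • (u x ⊗ₜ[ℝ] u x)) z i j) (extChartAt IX z z) =
      ρ z * vecCoord u z j (extChartAt IX z z) *
          partialD a b z j (vecCoord u z i) (extChartAt IX z z) +
        vecCoord u z i (extChartAt IX z z) *
          (ρ z * partialD a b z j (vecCoord u z j) (extChartAt IX z z)
            + vecCoord u z j (extChartAt IX z z) * partialD a b z j
              (fun y => ρ ((extChartAt IX z).symm y)) (extChartAt IX z z)) := by
    intro i j
    have h1 : tensorCoord (fun x => ρ x • (u x ⊗ₜ[ℝ] u x)) z i j = fun y =>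
        ρ ((extChartAt IX z).symm y) * (vecCoord u z i y * vecCoord u z j y) :=
      funext fun y => tensorCoord_smul_tmul ρ u z i j y
    have h2 := hR.hasFDerivAt.fun_mul ((hUi i).hasFDerivAt.fun_mul (hUi j).hasFDerivAt)
    simp only [partialD_eq_fderiv hy]
    rw [h1, h2.fderiv, extChartAt_to_inv]
    simp only [add_apply, smul_apply, smul_eq_mul]
    ring
  rw [dvg_smul G hab hρ hu hz]
  refine ext_coordFun fun i => ?_
  have hL : coordFun i (tensorDvg G (fun x => ρ x • (u x ⊗ₜ[ℝ] u x)) z) = _ :=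
    coordFun_sum_smul_basisVec (fun i => ∑ j, (partialD a b z j
      (tensorCoord (fun x => ρ x • (u x ⊗ₜ[ℝ] u x)) z i j) (extChartAt IX z z)
    + ∑ k, (christoffel G z i j k (extChartAt IX z z) *
          tensorCoord (fun x => ρ x • (u x ⊗ₜ[ℝ] u x)) z k j (extChartAt IX z z)
      + christoffel G z j j k (extChartAt IX z z) *
          tensorCoord (fun x => ρ x • (u x ⊗ₜ[ℝ] u x)) z i k (extChartAt IX z z)))) i
  have hC : coordFun i (covDeriv G u u z) = ∑ j, covDiff G u z i j * coordFun j (u z) :=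
    coordFun_sum_smul_basisVec (fun i => ∑ j, covDiff G u z i j * coordFun j (u z)) i
  have hS : ∀ (c d : ℝ) (v w : EX), coordFun i (c • v + d • w) =
      c * coordFun i v + d * coordFun i w := by simp
  refine hL.trans (Eq.trans ?_ (hS _ _ _ _).symm)
  rw [hC, scalarD_eq_fderiv u hρ hz hzz, map_eq_sum_coordFun
    (fderiv ℝ (fun y => ρ ((extChartAt IX z).symm y)) (extChartAt IX z z))]
  simp only [hprod, tensorCoord_smul_tmul, hcomp, dvg, covDiff, coordFun_vecRep, extChartAt_to_inv,
    ← partialD_eq_fderiv hy, smul_eq_mul]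
  simp only [Fin.sum_univ_three]
  ring

end

section

variable {M : Type*} [TopologicalSpace M] [ChartedSpace (EuclideanSpace ℝ (Fin 2)) M]

/-! ### Regularity of the thermodynamic quantities -/

theorem contMDiffOn_rpow {ρ : ScalarField M} {s : Set (ℝ × M)} {n : ℕ∞ω}
    (hρ : ContMDiffOn IX 𝓘(ℝ, ℝ) n ρ s) (hpos : ∀ z ∈ s, 0 < ρ z) (c : ℝ) :
    ContMDiffOn IX 𝓘(ℝ, ℝ) n (fun z => ρ z ^ c) s := by
  have h : ContDiffOn ℝ n (fun t : ℝ => t ^ c) (Ioi 0) := fun t ht =>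
    (Real.contDiffAt_rpow_const_of_ne (ne_of_gt ht)).contDiffWithinAt
  exact h.contMDiffOn.comp hρ fun z hz => hpos z hz

theorem contMDiffOn_inv {ρ : ScalarField M} {s : Set (ℝ × M)} {n : ℕ∞ω}
    (hρ : ContMDiffOn IX 𝓘(ℝ, ℝ) n ρ s) (hpos : ∀ z ∈ s, 0 < ρ z) :
    ContMDiffOn IX 𝓘(ℝ, ℝ) n (fun z => (ρ z)⁻¹) s := by
  have h : ContDiffOn ℝ n (fun t : ℝ => t⁻¹) (Ioi 0) := contDiffOn_id.inv fun t ht => ne_of_gt ht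
  exact h.contMDiffOn.comp hρ fun z hz => hpos z hz

theorem contMDiffOn_mul {f g : ScalarField M} {s : Set (ℝ × M)} {n : ℕ∞ω}
    (hf : ContMDiffOn IX 𝓘(ℝ, ℝ) n f s) (hg : ContMDiffOn IX 𝓘(ℝ, ℝ) n g s) :
    ContMDiffOn IX 𝓘(ℝ, ℝ) n (fun z => f z * g z) s :=
  (contDiff_mul (𝕜 := ℝ) (𝔸 := ℝ)).contMDiff.comp_contMDiffOn (hf.prodMk_space hg)

theorem pressure_pos {M : Type*} {a b γ k₀ cν : ℝ} (hk₀ : 0 < k₀) {p ρ s : ScalarField M}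
    (hρpos : ∀ z ∈ slab a b M, 0 < ρ z)
    (hstate : ∀ z ∈ slab a b M, p z = entropyA k₀ cν s z * ρ z ^ γ) :
    ∀ z ∈ slab a b M, 0 < p z := fun z hz => by
  rw [hstate z hz, entropyA]
  exact mul_pos (mul_pos hk₀ (Real.exp_pos _)) (Real.rpow_pos_of_pos (hρpos z hz) _)

theorem entropyA_eq {M : Type*} {a b γ k₀ cν : ℝ} {p ρ s : ScalarField M}
    (hρpos : ∀ z ∈ slab a b M, 0 < ρ z)
    (hstate : ∀ z ∈ slab a b M, p z = entropyA k₀ cν s z * ρ z ^ γ) :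
    ∀ z ∈ slab a b M, entropyA k₀ cν s z = p z * ρ z ^ (-γ) := fun z hz => by
  rw [hstate z hz, mul_assoc, ← Real.rpow_add (hρpos z hz), add_neg_cancel, Real.rpow_zero, mul_one]

/-- No regularity of `s` is assumed; that of A(s) comes from the state law, as A(s) = p ρ^(-γ). -/
theorem contMDiffOn_entropyA {a b γ k₀ cν : ℝ} {p ρ s : ScalarField M}
    (hp : ContMDiffOn IX 𝓘(ℝ, ℝ) 1 p (slab a b M))
    (hρ : ContMDiffOn IX 𝓘(ℝ, ℝ) 1 ρ (slab a b M)) (hρpos : ∀ z ∈ slab a b M, 0 < ρ z)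
    (hstate : ∀ z ∈ slab a b M, p z = entropyA k₀ cν s z * ρ z ^ γ) :
    ContMDiffOn IX 𝓘(ℝ, ℝ) 1 (entropyA k₀ cν s) (slab a b M) :=
  (contMDiffOn_mul hp (contMDiffOn_rpow hρ hρpos (-γ))).congr (entropyA_eq hρpos hstate)

theorem contMDiffOn_sonicSq {γ : ℝ} {p ρ : ScalarField M} {s : Set (ℝ × M)} {n : ℕ∞ω}
    (hp : ContMDiffOn IX 𝓘(ℝ, ℝ) n p s) (hρ : ContMDiffOn IX 𝓘(ℝ, ℝ) n ρ s)
    (hρpos : ∀ z ∈ s, 0 < ρ z) :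
    ContMDiffOn IX 𝓘(ℝ, ℝ) n (sonicSq γ p ρ) s := by
  refine (contMDiffOn_mul (contMDiffOn_mul (contMDiffOn_const (c := γ)) hp)
    (contMDiffOn_inv hρ hρpos)).congr fun z _ => ?_
  rw [sonicSq, div_eq_mul_inv]

theorem scalarD_congr {a b : ℝ} (u : VField M) {f g : ScalarField M} (h : ∀ z ∈ slab a b M, f z = g z)
    {z : ℝ × M} (hz : z ∈ slab a b M) : scalarD a b u f z = scalarD a b u g z := by
  rw [scalarD, scalarD]
  exact congrArg (fun L : EX →L[ℝ] ℝ => L (u z)) (mfderivWithin_congr h (h z hz))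

variable [IsManifold (𝓡 2) ∞ M] {a b : ℝ} (G : SlabMetric a b M)

theorem contMDiffOn_bernoulli {γ : ℝ} {p ρ : ScalarField M} {u : VField M}
    (hp : ContMDiffOn IX 𝓘(ℝ, ℝ) 1 p (slab a b M))
    (hρ : ContMDiffOn IX 𝓘(ℝ, ℝ) 1 ρ (slab a b M)) (hρpos : ∀ z ∈ slab a b M, 0 < ρ z)
    (hu : ContMDiffOn IX IX.tangent 1 u.toBundle (slab a b M)) :
    ContMDiffOn IX 𝓘(ℝ, ℝ) 1 (bernoulli G γ p ρ u) (slab a b M) := by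
  have h1 := contMDiffOn_mul (contMDiffOn_const (c := (1 / 2 : ℝ)))
    (contMDiffOn_inner_section G (by norm_cast) Subset.rfl hu hu)
  have h2 := contMDiffOn_mul (contMDiffOn_sonicSq (γ := γ) hp hρ hρpos)
    (contMDiffOn_const (c := (γ - 1)⁻¹))
  exact h1.add h2

/-! ### Derivatives along the flow -/

theorem scalarD_of_hasFDerivAt {F : ScalarField M} (u : VField M)
    (hF : ContMDiffOn IX 𝓘(ℝ, ℝ) 1 F (openSlab a b M)) {z : ℝ × M} (hz : z ∈ openSlab a b M)
    {L : EX →L[ℝ] ℝ}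
    (h : HasFDerivAt (fun y => F ((extChartAt IX z).symm y)) L (extChartAt IX z z)) :
    scalarD a b u F z = L (u z) := by
  rw [scalarD_eq_fderiv u hF hz (mem_extChartAt_source z), h.fderiv, vecRep_self]

theorem hasFDerivAt_scalarRep {F : ScalarField M}
    (hF : ContMDiffOn IX 𝓘(ℝ, ℝ) 1 F (openSlab a b M)) {z : ℝ × M} (hz : z ∈ openSlab a b M) :
    HasFDerivAt (fun y => F ((extChartAt IX z).symm y))
      (fderiv ℝ (fun y => F ((extChartAt IX z).symm y)) (extChartAt IX z z))
      (extChartAt IX z z) :=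
  ((contDiffAt_scalarRep (by norm_cast) hF hz (mem_extChartAt_source z)).differentiableAt
    (by norm_num)).hasFDerivAt

theorem scalarD_mul (u : VField M) {f g : ScalarField M}
    (hf : ContMDiffOn IX 𝓘(ℝ, ℝ) 1 f (openSlab a b M))
    (hg : ContMDiffOn IX 𝓘(ℝ, ℝ) 1 g (openSlab a b M)) {z : ℝ × M} (hz : z ∈ openSlab a b M) :
    scalarD a b u (fun x => f x * g x) z = f z * scalarD a b u g z + g z * scalarD a b u f z := by
  have h := scalarD_of_hasFDerivAt u (contMDiffOn_mul hf hg) hz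
    ((hasFDerivAt_scalarRep hf hz).fun_mul (hasFDerivAt_scalarRep hg hz))
  rw [h, scalarD_of_hasFDerivAt u hf hz (hasFDerivAt_scalarRep hf hz),
    scalarD_of_hasFDerivAt u hg hz (hasFDerivAt_scalarRep hg hz), extChartAt_to_inv]
  rfl

theorem scalarD_add (u : VField M) {f g : ScalarField M}
    (hf : ContMDiffOn IX 𝓘(ℝ, ℝ) 1 f (openSlab a b M))
    (hg : ContMDiffOn IX 𝓘(ℝ, ℝ) 1 g (openSlab a b M)) {z : ℝ × M} (hz : z ∈ openSlab a b M) :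
    scalarD a b u (fun x => f x + g x) z = scalarD a b u f z + scalarD a b u g z := by
  have h := scalarD_of_hasFDerivAt u (hf.add hg) hz
    ((hasFDerivAt_scalarRep hf hz).fun_add (hasFDerivAt_scalarRep hg hz))
  rw [scalarD_of_hasFDerivAt u hf hz (hasFDerivAt_scalarRep hf hz),
    scalarD_of_hasFDerivAt u hg hz (hasFDerivAt_scalarRep hg hz)]
  exact h

theorem scalarD_const_mul (u : VField M) {f : ScalarField M}
    (hf : ContMDiffOn IX 𝓘(ℝ, ℝ) 1 f (openSlab a b M)) (c : ℝ) {z : ℝ × M}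
    (hz : z ∈ openSlab a b M) :
    scalarD a b u (fun x => c * f x) z = c * scalarD a b u f z := by
  have h := scalarD_of_hasFDerivAt u (contMDiffOn_mul contMDiffOn_const hf) hz
    ((hasFDerivAt_scalarRep hf hz).const_mul c)
  rw [h, scalarD_of_hasFDerivAt u hf hz (hasFDerivAt_scalarRep hf hz)]
  rfl

theorem scalarD_rpow (u : VField M) {ρ : ScalarField M}
    (hρ : ContMDiffOn IX 𝓘(ℝ, ℝ) 1 ρ (openSlab a b M)) (hpos : ∀ z ∈ openSlab a b M, 0 < ρ z)
    (c : ℝ) {z : ℝ × M} (hz : z ∈ openSlab a b M) :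
    scalarD a b u (fun x => ρ x ^ c) z = c * ρ z ^ (c - 1) * scalarD a b u ρ z := by
  have h := scalarD_of_hasFDerivAt u (contMDiffOn_rpow hρ hpos c) hz
    ((hasFDerivAt_scalarRep hρ hz).rpow_const (p := c) (Or.inl (by
      rw [extChartAt_to_inv]
      exact (hpos z hz).ne')))
  rw [h, scalarD_of_hasFDerivAt u hρ hz (hasFDerivAt_scalarRep hρ hz), extChartAt_to_inv]
  rfl

theorem metricForm_vecRep (u v : VField M) {z : ℝ × M} {y : EX} (hy : y ∈ (extChartAt IX z).target) :
    metricForm G z y (vecRep u z y) (vecRep v z y) = G.inner ((extChartAt IX z).symm y)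
      (u ((extChartAt IX z).symm y)) (v ((extChartAt IX z).symm y)) := by
  have hx := (extChartAt IX z).map_target hy
  have hxx := mem_extChartAt_source (I := IX) ((extChartAt IX z).symm y)
  rw [metricForm_apply]
  exact congrArg₂ (fun p q : EX => G.inner ((extChartAt IX z).symm y) p q)
    (tangentCoordChange_inv hx hxx _) (tangentCoordChange_inv hx hxx _)

/-- Compatibility of the Levi-Civita connection with the metric. -/
theorem scalarD_inner_self (hab : a < b) {u : VField M}
    (hu : ContMDiffOn IX IX.tangent 1 u.toBundle (openSlab a b M)) {z : ℝ × M}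
    (hz : z ∈ openSlab a b M) :
    scalarD a b u (fun x => G.inner x (u x) (u x)) z = 2 * G.inner z (covDeriv G u u z) (u z) := by
  have hzz := mem_extChartAt_source (I := IX) z
  have hy := extChartAt_mem_coordOpenSlab hz hzz
  have hU := ((contDiffAt_vecRep hu hz hzz).differentiableAt (by norm_num)).hasFDerivAt
  have hg := (((contDiffOn_metricForm G z).contDiffAt (coordSlab_mem_nhds hy)).differentiableAt
    (by simp)).hasFDerivAt
  have h1 : HasFDerivAt (fun y => metricForm G z y (vecRep u z y) (vecRep u z y)) _ _ :=
    (hg.clm_apply hU).clm_apply hU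
  have h2 : (fun y => (fun x => G.inner x (u x) (u x)) ((extChartAt IX z).symm y)) =ᶠ[
      𝓝 (extChartAt IX z z)] fun y => metricForm G z y (vecRep u z y) (vecRep u z y) := by
    filter_upwards [(isOpen_target z).mem_nhds hy.1] with y hy
    exact (metricForm_vecRep G u u hy).symm
  rw [scalarD_of_hasFDerivAt u (contMDiffOn_inner_section G (by norm_cast) openSlab_subset_slab
    hu hu) hz (h1.congr_of_eventuallyEq h2)]
  have h3 : G.inner z (covDeriv G u u z) (u z) = metricForm G z (extChartAt IX z z)
      (covRep G u z (extChartAt IX z z) (u z)) (u z) := by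
    rw [← metricForm_self]
    exact congrArg (fun e => metricForm G z (extChartAt IX z z) e (u z))
      (covDeriv_self G hab u (openSlab_subset_slab hz) hU.differentiableAt.differentiableWithinAt)
  -- With all three arguments equal to `u`, two of the three Koszul terms cancel, leaving half the
  -- derivative of the metric along `u`.
  have h4 : metricForm G z (extChartAt IX z z) (covRep G u z (extChartAt IX z z) (u z)) (u z) =
      metricForm G z (extChartAt IX z z)
        (fderiv ℝ (vecRep u z) (extChartAt IX z z) (vecRep u z (extChartAt IX z z)))
        (vecRep u z (extChartAt IX z z)) +
      (1 / 2) * fderiv ℝ (metricForm G z) (extChartAt IX z z) (vecRep u z (extChartAt IX z z))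
        (vecRep u z (extChartAt IX z z)) (vecRep u z (extChartAt IX z z)) := by
    rw [← vecRep_self u z, covRep_apply, map_add, add_apply, metricForm_christoffelMap G hy,
      fderivWithin_coordSlab hy, christoffelFirst]
    ring
  rw [h3, h4, ← vecRep_self u z]
  simp only [add_apply, ContinuousLinearMap.comp_apply, ContinuousLinearMap.flip_apply]
  rw [metricForm_symm (coordOpenSlab_subset z hy) (vecRep u z (extChartAt IX z z))
    (fderiv ℝ (vecRep u z) (extChartAt IX z z) (vecRep u z (extChartAt IX z z)))]
  ring

section

variable {γ k₀ cν : ℝ} {f : VField M} {r p ρ s : ScalarField M} {u : VField M}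

/-- The factor ρ^(γ-1) clears the fractional powers left by differentiating A(s) = p ρ^(-γ). -/
theorem rpow_mul_scalarD_entropyA
    (hp : ContMDiffOn IX 𝓘(ℝ, ℝ) 1 p (slab a b M))
    (hρ : ContMDiffOn IX 𝓘(ℝ, ℝ) 1 ρ (slab a b M)) (hρpos : ∀ z ∈ slab a b M, 0 < ρ z)
    (hstate : ∀ z ∈ slab a b M, p z = entropyA k₀ cν s z * ρ z ^ γ) {z : ℝ × M}
    (hz : z ∈ openSlab a b M) :
    ρ z ^ (γ - 1) * scalarD a b u (entropyA k₀ cν s) z =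
      scalarD a b u p z / ρ z - γ * p z * scalarD a b u ρ z / ρ z ^ 2 := by
  have hsub : openSlab a b M ⊆ slab a b M := openSlab_subset_slab
  have hpos := hρpos z (hsub hz)
  rw [scalarD_congr u (entropyA_eq hρpos hstate) (hsub hz), scalarD_mul u (hp.mono hsub)
    (contMDiffOn_rpow (hρ.mono hsub) (fun z hz => hρpos z (hsub hz)) _) hz,
    scalarD_rpow u (hρ.mono hsub) (fun z hz => hρpos z (hsub hz)) _ hz]
  have h1 : ρ z ^ (γ - 1) * ρ z ^ (-γ) = (ρ z)⁻¹ := by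
    rw [← Real.rpow_add hpos, ← Real.rpow_neg_one]
    congr 1
    ring
  have h2 : ρ z ^ (γ - 1) * ρ z ^ (-γ - 1) = (ρ z ^ 2)⁻¹ := by
    rw [← Real.rpow_add hpos, ← Real.rpow_natCast, ← Real.rpow_neg hpos.le]
    congr 1
    push_cast
    ring
  rw [div_eq_mul_inv, div_eq_mul_inv, ← h1, ← h2]
  ring

theorem scalarD_bernoulli (hab : a < b)
    (hp : ContMDiffOn IX 𝓘(ℝ, ℝ) 1 p (slab a b M))
    (hρ : ContMDiffOn IX 𝓘(ℝ, ℝ) 1 ρ (slab a b M)) (hρpos : ∀ z ∈ slab a b M, 0 < ρ z)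
    (hu : ContMDiffOn IX IX.tangent 1 u.toBundle (slab a b M)) {z : ℝ × M}
    (hz : z ∈ openSlab a b M) :
    scalarD a b u (bernoulli G γ p ρ u) z = G.inner z (covDeriv G u u z) (u z) +
      γ / (γ - 1) * (scalarD a b u p z / ρ z - p z * scalarD a b u ρ z / ρ z ^ 2) := by
  have hsub : openSlab a b M ⊆ slab a b M := openSlab_subset_slab
  have hpos := hρpos z (hsub hz)
  have hi := contMDiffOn_inner_section G (by norm_cast) hsub (hu.mono hsub) (hu.mono hsub)
  have hρi := contMDiffOn_rpow (hρ.mono hsub) (fun z hz => hρpos z (hsub hz)) (-1)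
  have hE : ∀ x ∈ slab a b M, bernoulli G γ p ρ u x =
      (1 / 2) * G.inner x (u x) (u x) + γ / (γ - 1) * (p x * ρ x ^ (-1 : ℝ)) := fun x hx => by
    rw [bernoulli, sonicSq, Real.rpow_neg_one]
    ring
  rw [scalarD_congr u hE (hsub hz), scalarD_add u (contMDiffOn_mul contMDiffOn_const hi)
    (contMDiffOn_mul contMDiffOn_const (contMDiffOn_mul (hp.mono hsub) hρi)) hz,
    scalarD_const_mul u hi _ hz, scalarD_const_mul u (contMDiffOn_mul (hp.mono hsub) hρi) _ hz,
    scalarD_mul u (hp.mono hsub) hρi hz, scalarD_inner_self G hab (hu.mono hsub) hz,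
    scalarD_rpow u (hρ.mono hsub) (fun z hz => hρpos z (hsub hz)) _ hz, Real.rpow_neg_one]
  have h2 : ρ z ^ (-1 - 1 : ℝ) = (ρ z ^ 2)⁻¹ := by
    rw [← Real.rpow_natCast, ← Real.rpow_neg hpos.le]
    norm_num
  rw [h2]
  ring

theorem inner_resMomentum {z : ℝ × M} (hz : z ∈ slab a b M)
    (hp : ContMDiffOn IX 𝓘(ℝ, ℝ) 1 p (slab a b M)) :
    G.inner z (resMomentum G f p ρ u z) (u z) = G.inner z (covDeriv G u u z) (u z) +
      scalarD a b u p z / ρ z - G.inner z (f z) (u z) := by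
  rw [resMomentum, map_sub, map_add, map_smul, ← inner_grad G u hz
    ((hp z hz).mdifferentiableWithinAt (by norm_num))]
  simp only [sub_apply, add_apply, smul_apply, smul_eq_mul]
  ring

/-- The energy residual in terms of the momentum and the entropy residuals. -/
theorem resBernoulli_eq (hab : a < b) (hγ : 1 < γ)
    (hp : ContMDiffOn IX 𝓘(ℝ, ℝ) 1 p (slab a b M))
    (hρ : ContMDiffOn IX 𝓘(ℝ, ℝ) 1 ρ (slab a b M)) (hρpos : ∀ z ∈ slab a b M, 0 < ρ z)
    (hstate : ∀ z ∈ slab a b M, p z = entropyA k₀ cν s z * ρ z ^ γ)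
    (hu : ContMDiffOn IX IX.tangent 1 u.toBundle (slab a b M)) {z : ℝ × M}
    (hz : z ∈ openSlab a b M) :
    resBernoulli G γ f r p ρ u z = G.inner z (resMomentum G f p ρ u z) (u z) +
      ρ z ^ (γ - 1) / (γ - 1) * resEntropy a b γ k₀ cν r ρ s u z := by
  have hpos := hρpos z (openSlab_subset_slab hz)
  have hA := rpow_mul_scalarD_entropyA (u := u) hp hρ hρpos hstate hz
  have hγ' : γ - 1 ≠ 0 := by linarith
  have hρ' : ρ z ^ (γ - 1) ≠ 0 := (Real.rpow_pos_of_pos hpos _).ne'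
  -- The claim then rests on γ/(γ-1) = 1 + 1/(γ-1): the first summand is the pressure work contained
  -- in G(R_u, u), the second belongs to the entropy residual.
  have h1 : ρ z ^ (γ - 1) / (γ - 1) * resEntropy a b γ k₀ cν r ρ s u z =
      (scalarD a b u p z / ρ z - γ * p z * scalarD a b u ρ z / ρ z ^ 2 - (γ - 1) * r z)
        / (γ - 1) := by
    rw [← hA, resEntropy]
    field_simp
  rw [h1, inner_resMomentum G (openSlab_subset_slab hz) hp, resBernoulli,
    scalarD_bernoulli G hab hp hρ hρpos hu hz]
  field_simp
  ring

/-- The mass residual in terms of the mass flux and the entropy residual. -/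
theorem resMass_eq (hab : a < b) (hγ : 1 < γ) (hk₀ : 0 < k₀)
    (hp : ContMDiffOn IX 𝓘(ℝ, ℝ) 1 p (slab a b M))
    (hρ : ContMDiffOn IX 𝓘(ℝ, ℝ) 1 ρ (slab a b M)) (hρpos : ∀ z ∈ slab a b M, 0 < ρ z)
    (hstate : ∀ z ∈ slab a b M, p z = entropyA k₀ cν s z * ρ z ^ γ)
    (hu : ContMDiffOn IX IX.tangent 1 u.toBundle (slab a b M)) {z : ℝ × M}
    (hz : z ∈ openSlab a b M) :
    resMass G γ r p ρ u z = dvg G (fun x => ρ x • u x) z / ρ z +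
      ρ z * ρ z ^ (γ - 1) / (γ * p z) * resEntropy a b γ k₀ cν r ρ s u z := by
  have hsub : openSlab a b M ⊆ slab a b M := openSlab_subset_slab
  have hpos := hρpos z (hsub hz)
  have hppos := pressure_pos hk₀ hρpos hstate z (hsub hz)
  have hA := rpow_mul_scalarD_entropyA (u := u) hp hρ hρpos hstate hz
  have hρ' : ρ z ^ (γ - 1) ≠ 0 := (Real.rpow_pos_of_pos hpos _).ne'
  have hγ' : γ ≠ 0 := by linarith
  have h1 : ρ z * ρ z ^ (γ - 1) / (γ * p z) * resEntropy a b γ k₀ cν r ρ s u z =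
      ρ z / (γ * p z) * (scalarD a b u p z / ρ z - γ * p z * scalarD a b u ρ z / ρ z ^ 2
        - (γ - 1) * r z) := by
    rw [← hA, resEntropy]
    field_simp
  rw [h1, dvg_smul G hab (hρ.mono hsub) (hu.mono hsub) hz, resMass, sonicSq]
  field_simp
  ring

/-- Passing from conservation to transport form costs only a multiple of the mass flux divergence,
which the mass equation removes. -/
theorem momentum_flux_eq (hab : a < b)
    (hρ : ContMDiffOn IX 𝓘(ℝ, ℝ) 1 ρ (slab a b M)) (hρpos : ∀ z ∈ slab a b M, 0 < ρ z)
    (hu : ContMDiffOn IX IX.tangent 1 u.toBundle (slab a b M)) {z : ℝ × M}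
    (hz : z ∈ openSlab a b M) :
    tensorDvg G (fun x => ρ x • (u x ⊗ₜ[ℝ] u x)) z + grad G p z - ρ z • f z =
      ρ z • resMomentum G f p ρ u z + dvg G (fun x => ρ x • u x) z • u z := by
  have hpos := hρpos z (openSlab_subset_slab hz)
  rw [tensorDvg_smul_tmul G hab (hρ.mono openSlab_subset_slab) (hu.mono openSlab_subset_slab) hz,
    resMomentum, smul_sub, smul_add, smul_smul, mul_inv_cancel₀ hpos.ne', one_smul]
  abel

theorem energy_flux_eq (hab : a < b)
    (hp : ContMDiffOn IX 𝓘(ℝ, ℝ) 1 p (slab a b M))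
    (hρ : ContMDiffOn IX 𝓘(ℝ, ℝ) 1 ρ (slab a b M)) (hρpos : ∀ z ∈ slab a b M, 0 < ρ z)
    (hu : ContMDiffOn IX IX.tangent 1 u.toBundle (slab a b M)) {z : ℝ × M}
    (hz : z ∈ openSlab a b M) :
    dvg G (fun x => (ρ x * bernoulli G γ p ρ u x) • u x) z
      - ρ z * G.inner z (f z) (u z) - ρ z * r z =
      ρ z * resBernoulli G γ f r p ρ u z +
        bernoulli G γ p ρ u z * dvg G (fun x => ρ x • u x) z := by
  have hsub : openSlab a b M ⊆ slab a b M := openSlab_subset_slab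
  have hE := (contMDiffOn_bernoulli G (γ := γ) hp hρ hρpos hu).mono hsub
  rw [dvg_smul G hab (contMDiffOn_mul (hρ.mono hsub) hE) (hu.mono hsub) hz,
    dvg_smul G hab (hρ.mono hsub) (hu.mono hsub) hz, scalarD_mul u (hρ.mono hsub) hE hz,
    resBernoulli]
  ring

/-- The Euler system in terms of the residuals. -/
theorem solvesEuler_iff (hab : a < b) (hγ : 1 < γ) (hk₀ : 0 < k₀)
    (hp : ContMDiffOn IX 𝓘(ℝ, ℝ) 1 p (slab a b M))
    (hρ : ContMDiffOn IX 𝓘(ℝ, ℝ) 1 ρ (slab a b M)) (hρpos : ∀ z ∈ slab a b M, 0 < ρ z)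
    (hstate : ∀ z ∈ slab a b M, p z = entropyA k₀ cν s z * ρ z ^ γ)
    (hu : ContMDiffOn IX IX.tangent 1 u.toBundle (slab a b M)) :
    SolvesEuler G γ f r p ρ u ↔
      (∀ z ∈ openSlab a b M, resMomentum G f p ρ u z = 0) ∧
      (∀ z ∈ openSlab a b M, resEntropy a b γ k₀ cν r ρ s u z = 0) ∧
      (∀ z ∈ openSlab a b M, resMass G γ r p ρ u z = 0) := by
  have hγ' : γ - 1 ≠ 0 := by linarith
  constructor
  · intro h
    have hR : ∀ z ∈ openSlab a b M, resMomentum G f p ρ u z = 0 := fun z hz => by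
      have h1 := h.momentum z hz
      rw [momentum_flux_eq G hab hρ hρpos hu hz, h.mass z hz, zero_smul, add_zero] at h1
      exact (smul_eq_zero.1 h1).resolve_left (hρpos z (openSlab_subset_slab hz)).ne'
    have hA : ∀ z ∈ openSlab a b M, resEntropy a b γ k₀ cν r ρ s u z = 0 := fun z hz => by
      have hpos := hρpos z (openSlab_subset_slab hz)
      have h1 := h.energy z hz
      rw [energy_flux_eq G hab hp hρ hρpos hu hz, h.mass z hz, mul_zero, add_zero] at h1
      have h2 := (mul_eq_zero.1 h1).resolve_left hpos.ne'
      rw [resBernoulli_eq G hab hγ hp hρ hρpos hstate hu hz, hR z hz, map_zero, zero_apply,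
        zero_add] at h2
      exact (mul_eq_zero.1 h2).resolve_left
        (div_ne_zero (Real.rpow_pos_of_pos hpos _).ne' hγ')
    refine ⟨hR, hA, fun z hz => ?_⟩
    rw [resMass_eq G hab hγ hk₀ hp hρ hρpos hstate hu hz, h.mass z hz, hA z hz]
    simp
  · rintro ⟨hR, hA, hm⟩
    have hmass : ∀ z ∈ openSlab a b M, dvg G (fun x => ρ x • u x) z = 0 := fun z hz => by
      have h1 := hm z hz
      rw [resMass_eq G hab hγ hk₀ hp hρ hρpos hstate hu hz, hA z hz, mul_zero, add_zero] at h1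
      exact (div_eq_zero_iff.1 h1).resolve_right (hρpos z (openSlab_subset_slab hz)).ne'
    refine ⟨fun z hz => ?_, hmass, fun z hz => ?_⟩
    · rw [momentum_flux_eq G hab hρ hρpos hu hz, hR z hz, hmass z hz, smul_zero, zero_smul,
        add_zero]
    · rw [energy_flux_eq G hab hp hρ hρpos hu hz, hmass z hz,
        resBernoulli_eq G hab hγ hp hρ hρpos hstate hu hz, hR z hz, hA z hz, map_zero, zero_apply]
      simp

end

end

/-! ### A maximum principle for transport equations -/

theorem eventually_lt_of_hasDerivAt_pos {f : ℝ → ℝ} {f' : ℝ} (hf : HasDerivAt f f' 0)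
    (hf' : 0 < f') : ∀ᶠ t in 𝓝[>] (0 : ℝ), f 0 < f t := by
  have h1 : ∀ᶠ t in 𝓝[>] (0 : ℝ), 0 < slope f 0 t :=
    ((hasDerivAt_iff_tendsto_slope.1 hf).mono_left
      (nhdsWithin_mono _ fun t ht => ne_of_gt ht)).eventually (lt_mem_nhds hf')
  filter_upwards [h1, self_mem_nhdsWithin] with t h1 ht
  rw [slope_def_field, sub_zero] at h1
  have h2 := (div_pos_iff_of_pos_right ht).1 h1
  linarith

theorem hasDerivAt_comp_mul {f : ℝ → ℝ} {f' : ℝ} (hf : HasDerivAt f f' 0) (σ : ℝ) :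
    HasDerivAt (fun t => f (σ * t)) (σ * f') 0 := by
  have h1 : HasDerivAt (fun t : ℝ => σ * t) σ 0 := by
    simpa using (hasDerivAt_id (0 : ℝ)).const_mul σ
  have h2 : HasDerivAt f f' (σ * 0) := by simpa using hf
  rw [mul_comm]
  exact HasDerivAt.comp (0 : ℝ) h2 h1

/-- A solution of a linear transport equation on a slab whose streamlines are transversal to the
slices vanishes if it vanishes on the slice `{b} × M`. -/
theorem eq_zero_of_transport {M : Type*} [TopologicalSpace M] [CompactSpace M] {a b : ℝ}
    {w v L : ℝ × M → ℝ} (hw : ContinuousOn w (Ioc a b ×ˢ univ)) (hb : ∀ x, w (b, x) = 0)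
    (hv : ContinuousOn v (slab a b M)) (hv0 : ∀ z ∈ slab a b M, v z ≠ 0)
    (hL : ContinuousOn L (slab a b M))
    (hX : ∀ z ∈ openSlab a b M, ∃ X : ℝ → ℝ × M, X 0 = z ∧ ContinuousAt X 0 ∧
      HasDerivAt (fun t => (X t).1) (v z) 0 ∧ HasDerivAt (fun t => w (X t)) (-(L z * w z)) 0) :
    ∀ z ∈ openSlab a b M, w z = 0 := by
  intro z₁ hz₁
  by_contra hne
  have hcomp : IsCompact (slab a b M) := isCompact_Icc.prod isCompact_univ
  -- Dividing by `v` measures the zeroth-order term per unit of x⁰. The exponent 2c with c = C + 1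
  -- makes the growth of the weight in x⁰ dominate it.
  obtain ⟨C, hC⟩ := hcomp.exists_bound_of_continuousOn (hL.div hv hv0)
  set c := C + 1 with hc
  let ψ : ℝ × M → ℝ := fun z => w z ^ 2 * Real.exp (2 * c * z.1)
  -- Starting at the slice of `z₁` keeps the compact set away from x⁰ = a, where `w` is not known to
  -- be continuous. A maximum on this lower slice does no harm, since the comparison below moves
  -- towards `b`.
  have hK : IsCompact (Icc z₁.1 b ×ˢ (univ : Set M)) := isCompact_Icc.prod isCompact_univ
  have hKsub : Icc z₁.1 b ×ˢ (univ : Set M) ⊆ Ioc a b ×ˢ univ :=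
    prod_mono (fun t ht => ⟨hz₁.1.1.trans_le ht.1, ht.2⟩) Subset.rfl
  have hz₁K : z₁ ∈ Icc z₁.1 b ×ˢ (univ : Set M) := ⟨⟨le_rfl, hz₁.1.2.le⟩, trivial⟩
  have hψ : ContinuousOn ψ (Icc z₁.1 b ×ˢ univ) := by
    refine ((hw.mono hKsub).pow 2).mul (Continuous.continuousOn ?_)
    fun_prop
  obtain ⟨z, hzK, hmax⟩ := hK.exists_isMaxOn ⟨z₁, hz₁K⟩ hψ
  have hpos : 0 < ψ z := by
    refine lt_of_lt_of_le ?_ (hmax hz₁K)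
    have := Real.exp_pos (2 * c * z₁.1)
    positivity
  have hwz : w z ≠ 0 := fun h => by simp [ψ, h] at hpos
  have hzb : z.1 < b := by
    refine lt_of_le_of_ne hzK.1.2 fun h => hwz ?_
    have h1 := hb z.2
    rwa [← h] at h1
  have hzo : z ∈ openSlab a b M := ⟨⟨(hKsub hzK).1.1, hzb⟩, trivial⟩
  have hzs := openSlab_subset_slab hzo
  obtain ⟨X, hX0, hXc, hX1, hXw⟩ := hX z hzo
  have hψX : HasDerivAt (fun t => ψ (X t))
      (2 * w z ^ 2 * Real.exp (2 * c * z.1) * (c * v z - L z)) 0 := by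
    have h := (hXw.fun_pow 2).fun_mul ((hX1.const_mul (2 * c)).exp)
    refine h.congr_deriv ?_
    simp only [hX0]
    push_cast
    ring
  -- Time is rescaled, and reversed if necessary, so that x⁰ increases along the streamline. In that
  -- direction ψ strictly increases to first order, contradicting maximality.
  obtain ⟨σ, hσ⟩ : ∃ σ : ℝ, 0 < σ * v z :=
    ⟨v z, mul_self_pos.2 (hv0 z hzs)⟩
  have hq : 0 < σ * (c * v z - L z) := by
    have h1 : L z / v z ≤ C := (le_abs_self _).trans (hC z hzs)
    have h2 : σ * (c * v z - L z) = σ * v z * (c - L z / v z) := by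
      have := hv0 z hzs
      field_simp
    rw [h2]
    refine mul_pos hσ ?_
    linarith
  have h1 := eventually_lt_of_hasDerivAt_pos (hasDerivAt_comp_mul hX1 σ) hσ
  have h2 := eventually_lt_of_hasDerivAt_pos (hasDerivAt_comp_mul hψX σ) (by
    have : 0 < 2 * w z ^ 2 * Real.exp (2 * c * z.1) := by positivity
    nlinarith [mul_pos this hq])
  have h3 : ∀ᶠ t in 𝓝[>] (0 : ℝ), (X (σ * t)).1 < b := by
    have h4 : ContinuousAt (fun t => (X (σ * t)).1) 0 := (hasDerivAt_comp_mul hX1 σ).continuousAt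
    refine nhdsWithin_le_nhds (h4.eventually (gt_mem_nhds ?_))
    simpa [hX0] using hzb
  obtain ⟨t, ht1, ht2, ht3⟩ := (h1.and (h2.and h3)).exists
  simp only [mul_zero, hX0] at ht1 ht2
  have h5 : X (σ * t) ∈ Icc z₁.1 b ×ˢ (univ : Set M) := ⟨⟨hzK.1.1.trans ht1.le, ht3.le⟩, trivial⟩
  exact absurd (hmax h5) (not_le.2 ht2)

section

variable {M : Type*} [TopologicalSpace M] [ChartedSpace (EuclideanSpace ℝ (Fin 2)) M]
  [IsManifold (𝓡 2) ∞ M] {a b : ℝ} (G : SlabMetric a b M)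

/-! ### The component normal to the slices -/

/-- All charts share the coordinate x⁰, so its differential is the same in each; hence u⁰ is a
globally defined continuous function. -/
theorem coordFun_zero_tangentCoordChange {x z : ℝ × M} (hx : x ∈ (extChartAt IX z).source)
    (v : EX) : coordFun 0 (tangentCoordChange IX x z x v) = coordFun 0 v := by
  have h1 : HasFDerivAt (fun y => coordFun 0 (transition x z y))
      ((coordFun 0).comp (tangentCoordChange IX x z x)) (extChartAt IX x x) := by
    refine (coordFun 0).hasFDerivAt.comp _ ?_
    rw [← fderiv_transition]
    exact ((contDiffAt_transition hx).differentiableAt (by simp)).hasFDerivAt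
  have h2 : (fun y => coordFun 0 (transition x z y)) = coordFun 0 := funext fun y => by
    change (extChartAt IX z ((extChartAt IX x).symm y)).1 = y.1
    rw [extChartAt_fst, extChartAt_symm_fst]
  rw [h2] at h1
  exact DFunLike.congr_fun (h1.unique (coordFun 0).hasFDerivAt) v

theorem continuousOn_comp_zero {u : VField M} (hu : ContinuousOn u.toBundle (slab a b M)) :
    ContinuousOn (fun z => comp z 0 (u z)) (slab a b M) := by
  intro z hz
  have hzz := mem_extChartAt_source (I := IX) z
  refine tendsto_of_chart Subset.rfl (H := fun y => coordFun 0 (vecRep u z y)) ?_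
    (fun x hxo hx => ?_) ?_
  · exact ((coordFun 0).continuous.comp_continuousOn (continuousOn_vecRep hu z)) _
      (extChartAt_mem_coordSlab hz hzz)
  · rw [vecRep_extChartAt u hx]
    exact (coordFun_zero_tangentCoordChange hx (u x)).symm
  · rw [vecRep_self]
    rfl

/-- A vector orthogonal to the slices and to a vector transversal to them vanishes. -/
theorem eq_zero_of_inner {z : ℝ × M} (hz : z ∈ slab a b M) {R u : TangentSpace IX z}
    (ht : ∀ α : Fin 2, G.inner z R (pd z α.succ) = 0) (hRu : G.inner z R u = 0)
    (hu : G.inner z u (pd z 0) ≠ 0) : R = 0 := by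
  -- The covector G(R, ·) annihilates ∂₁ and ∂₂, so it is a multiple of dx⁰; its value on `u`, where
  -- u⁰ ≠ 0, shows that the multiple is zero.
  have hexp : ∀ v : TangentSpace IX z, G.inner z R v = comp z 0 v * G.inner z R (pd z 0) := by
    intro v
    have h := map_eq_sum_coordFun (F := ℝ) (G.inner z R) v
    rw [Fin.sum_univ_succ] at h
    refine h.trans ?_
    have h2 : ∑ α : Fin 2, coordFun α.succ v • G.inner z R (basisVec α.succ) = 0 :=
      Finset.sum_eq_zero fun α _ => by
        have h3 : G.inner z R (basisVec α.succ) = 0 := ht α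
        rw [h3, smul_zero]
    exact (congrArg (_ + ·) h2).trans (add_zero _)
  have h0 : G.inner z R (pd z 0) = 0 := by
    rw [hexp u] at hRu
    rw [G.inner_pd_zero z hz] at hu
    exact (mul_eq_zero.1 hRu).resolve_left hu
  by_contra hne
  have h1 := G.pos z hz R hne
  rw [hexp R, h0, mul_zero] at h1
  exact lt_irrefl _ h1

end

section

variable {M : Type*} [TopologicalSpace M] [ChartedSpace (EuclideanSpace ℝ (Fin 2)) M]
  [IsManifold (𝓡 2) ∞ M] {a b : ℝ} (G : SlabMetric a b M)
  {γ k₀ cν : ℝ} {f : VField M} {r p ρ s : ScalarField M} {u : VField M}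

/-! ### The mass residual along the flow -/

theorem contMDiffOn_scalarD (hp : ContMDiffOn IX 𝓘(ℝ, ℝ) 2 p (openSlab a b M))
    (hu : ContMDiffOn IX IX.tangent 1 u.toBundle (openSlab a b M)) :
    ContMDiffOn IX 𝓘(ℝ, ℝ) 1 (scalarD a b u p) (openSlab a b M) := by
  intro z hz
  have hzz := mem_extChartAt_source (I := IX) z
  have h1 : ContDiffAt ℝ 1 (fun y => fderiv ℝ (fun y => p ((extChartAt IX z).symm y)) y
      (vecRep u z y)) (extChartAt IX z z) :=
    ((contDiffAt_scalarRep (by norm_cast) hp hz hzz).fderiv_right (m := 1) (by norm_num)).clm_apply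
      (contDiffAt_vecRep hu hz hzz)
  have h2 : ContMDiffAt IX 𝓘(ℝ, ℝ) 1 (fun x => fderiv ℝ (fun y => p ((extChartAt IX z).symm y))
      (extChartAt IX z x) (vecRep u z (extChartAt IX z x))) z :=
    h1.contMDiffAt.comp z ((contMDiffAt_extChartAt (n := ∞)).of_le (by norm_cast))
  refine (h2.congr_of_eventuallyEq ?_).contMDiffWithinAt
  filter_upwards [isOpen_openSlab.mem_nhds hz, (isOpen_extChartAt_source z).mem_nhds hzz] with x h3 h4
  exact scalarD_eq_fderiv u (hp.of_le (by norm_num)) h3 h4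

theorem contDiffAt_gradRep (hp : ContMDiffOn IX 𝓘(ℝ, ℝ) 2 p (openSlab a b M)) {z : ℝ × M}
    (hz : z ∈ openSlab a b M) : ContDiffAt ℝ 1 (gradRep G p z) (extChartAt IX z z) := by
  have hzz := mem_extChartAt_source (I := IX) z
  have hy := extChartAt_mem_coordOpenSlab hz hzz
  have h1 : ContDiffAt ℝ 1 (fderivWithin ℝ (fun y => p ((extChartAt IX z).symm y))
      (coordSlab a b z)) (extChartAt IX z z) := by
    refine ((contDiffAt_scalarRep (by norm_cast) hp hz hzz).fderiv_right (m := 1)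
      (by norm_num)).congr_of_eventuallyEq ?_
    filter_upwards [(isOpen_coordOpenSlab z).mem_nhds hy] with y hy'
    exact fderivWithin_coordSlab hy'
  exact ContDiffAt.sum fun i _ => ContDiffAt.smul (ContDiffAt.sum fun j _ =>
    (((contDiffOn_metricCoord_inv G z i j).contDiffAt (coordSlab_mem_nhds hy)).of_le
      (by norm_cast)).mul (h1.clm_apply contDiffAt_const)) contDiffAt_const

theorem covDiff_eq_fderiv (hab : a < b)
    (hu : ContMDiffOn IX IX.tangent 1 u.toBundle (openSlab a b M)) {z : ℝ × M}
    (hz : z ∈ openSlab a b M) (i j : Fin 3) :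
    covDiff G u z i j = coordFun i (fderiv ℝ (vecRep u z) (extChartAt IX z z) (basisVec j)) +
      ∑ k, christoffel G z i j k (extChartAt IX z z) *
        coordFun k (vecRep u z (extChartAt IX z z)) := by
  rw [covDiff_eq_covRep G hab (openSlab_subset_slab hz)
    (differentiableWithinAt_vecRep_of_openSlab hu hz), covRep_apply, map_add,
    coordFun_christoffelMap_basisVec, fderivWithin_coordSlab
      (extChartAt_mem_coordOpenSlab hz (mem_extChartAt_source z))]

theorem ricci_eq_fderiv {z : ℝ × M} (hz : z ∈ openSlab a b M) :
    ricci G z (u z) (u z) = ∑ i, ∑ j,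
      (∑ k, (fderiv ℝ (christoffel G z k i j) (extChartAt IX z z) (basisVec k)
        - fderiv ℝ (christoffel G z k i k) (extChartAt IX z z) (basisVec j)
        + ∑ l, (christoffel G z k k l (extChartAt IX z z) * christoffel G z l i j (extChartAt IX z z)
          - christoffel G z k j l (extChartAt IX z z) *
            christoffel G z l i k (extChartAt IX z z))))
        * coordFun i (vecRep u z (extChartAt IX z z))
        * coordFun j (vecRep u z (extChartAt IX z z)) := by
  have hy := extChartAt_mem_coordOpenSlab hz (mem_extChartAt_source (I := IX) z)
  simp only [ricci, ricciCoord, partialD_eq_fderiv hy, vecRep_self]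
  rfl

theorem dvg_eq_fderiv (hab : a < b) {z : ℝ × M} (hz : z ∈ openSlab a b M) {w : VField M}
    {F : EX → EX} (hF : DifferentiableAt ℝ F (extChartAt IX z z))
    (hwF : vecRep w z =ᶠ[𝓝 (extChartAt IX z z)] F) :
    dvg G w z = ∑ i, (coordFun i (fderiv ℝ F (extChartAt IX z z) (basisVec i)) +
      ∑ k, christoffel G z i i k (extChartAt IX z z) * coordFun k (F (extChartAt IX z z))) := by
  rw [dvg_self G hab (openSlab_subset_slab hz)
    (hF.congr_of_eventuallyEq hwF).differentiableWithinAt,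
    divRep_eq G (extChartAt_mem_coordOpenSlab hz (mem_extChartAt_source z)), hwF.fderiv_eq,
    hwF.eq_of_nhds]

/-- If the momentum equation holds, the derivative of the mass residual along the streamlines is
the second-order expression in the pressure. -/
theorem exists_streamline (hab : a < b) (hγ : 1 < γ)
    (hf : ContMDiffOn IX IX.tangent 1 f.toBundle (openSlab a b M))
    (hr : ContMDiffOn IX 𝓘(ℝ, ℝ) 1 r (openSlab a b M))
    (hp : ContMDiffOn IX 𝓘(ℝ, ℝ) 2 p (openSlab a b M))
    (hppos : ∀ z ∈ openSlab a b M, 0 < p z)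
    (hρ : ContMDiffOn IX 𝓘(ℝ, ℝ) 1 ρ (openSlab a b M)) (hρpos : ∀ z ∈ openSlab a b M, 0 < ρ z)
    (hu : ContMDiffOn IX IX.tangent 1 u.toBundle (openSlab a b M))
    (hR : ∀ z ∈ openSlab a b M, resMomentum G f p ρ u z = 0)
    {z : ℝ × M} (hz : z ∈ openSlab a b M) :
    ∃ X : ℝ → ℝ × M, X 0 = z ∧ ContinuousAt X 0 ∧
      HasDerivAt (fun t => (X t).1) (comp z 0 (u z)) 0 ∧
      HasDerivAt (fun t => resMass G γ r p ρ u (X t)) (pressureOp G γ f r p ρ u z) 0 := by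
  have hzz := mem_extChartAt_source (I := IX) z
  have hy := extChartAt_mem_coordOpenSlab hz hzz
  have hp1 : ContMDiffOn IX 𝓘(ℝ, ℝ) 1 p (openSlab a b M) := hp.of_le (by norm_num)
  have hU := contDiffAt_vecRep hu hz hzz
  have hγ0 : 0 < γ := by linarith
  -- an integral curve in coordinates
  obtain ⟨r₀, hr₀, ε, hε, hode⟩ :=
    hU.exists_forall_mem_closedBall_exists_eq_forall_mem_Ioo_hasDerivAt 0
  obtain ⟨ξ, hξ0, hξ⟩ := hode _ (Metric.mem_closedBall_self hr₀.le)
  have hξ' : ∀ᶠ t in 𝓝 (0 : ℝ), HasDerivAt ξ (vecRep u z (ξ t)) t := by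
    filter_upwards [Ioo_mem_nhds (by linarith : (0 : ℝ) - ε < 0) (by linarith : (0 : ℝ) < 0 + ε)]
      with t ht
    exact hξ t ht
  have hξd := hξ'.self_of_nhds
  have hξo : ∀ᶠ t in 𝓝 (0 : ℝ), ξ t ∈ coordOpenSlab a b z :=
    hξd.continuousAt.eventually (by rw [hξ0]; exact (isOpen_coordOpenSlab z).mem_nhds hy)
  -- the acceleration
  let F : EX → EX := fun y => vecRep f z y - (ρ ((extChartAt IX z).symm y))⁻¹ • gradRep G p z y
  have hρrep := contDiffAt_scalarRep (by norm_cast) hρ hz hzz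
  have hgrad : ContDiffAt ℝ 1
      (fun y => (ρ ((extChartAt IX z).symm y))⁻¹ • gradRep G p z y) (extChartAt IX z z) := by
    refine (hρrep.inv ?_).smul (contDiffAt_gradRep G hp hz)
    rw [extChartAt_to_inv]
    exact (hρpos z hz).ne'
  have hF : ContDiffAt ℝ 1 F (extChartAt IX z z) := (contDiffAt_vecRep hf hz hzz).sub hgrad
  -- The momentum equation on a whole neighbourhood identifies D_u u with the C^1 field `F`, which
  -- is what the divergence identity requires.
  have hFU : ∀ᶠ y in 𝓝 (extChartAt IX z z), F y = fderiv ℝ (vecRep u z) y (vecRep u z y) +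
      christoffelMap G z y (vecRep u z y) (vecRep u z y) := by
    filter_upwards [(isOpen_coordOpenSlab z).mem_nhds hy] with y hy'
    have h1 := resMomentum_eq G hab (f := f) (ρ := ρ) hp1 hu hy'.2
      ((extChartAt IX z).map_target hy'.1)
    rw [(extChartAt IX z).right_inv hy'.1] at h1
    have h2 : momentumRep G f p ρ u z y = 0 := by
      rw [← h1]
      exact (congrArg (tangentCoordChange IX _ z _) (hR _ hy'.2)).trans (map_zero _)
    rw [momentumRep, covRep_apply, fderivWithin_coordSlab hy', sub_eq_zero] at h2
    exact (eq_sub_of_add_eq h2).symm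
  have hdiv := hasDerivAt_divergence_integralCurve (Γ := christoffel G z) (U := vecRep u z) (F := F)
    (X := ξ)
    (fun k i j => by
      rw [hξ0]
      exact (contDiffOn_christoffel G z k i j).contDiffAt ((isOpen_coordOpenSlab z).mem_nhds hy))
    (fun k i j => by
      rw [hξ0]
      filter_upwards [(isOpen_coordOpenSlab z).mem_nhds hy] with y hy'
      exact christoffel_symm (coordOpenSlab_subset z hy') k i j)
    (by rwa [hξ0]) (by rwa [hξ0]) (by rw [hξ0]; exact hFU) hξ'
  rw [hξ0] at hdiv
  -- the first-order part
  have hDp := contMDiffOn_mul (contMDiffOn_scalarD hp hu) (contMDiffOn_inv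
    (contMDiffOn_mul (contMDiffOn_const (c := γ)) hp1) fun x hx => mul_pos hγ0 (hppos x hx))
  have hc2 : ∀ x ∈ openSlab a b M, 0 < sonicSq γ p ρ x := fun x hx =>
    div_pos (mul_pos hγ0 (hppos x hx)) (hρpos x hx)
  have hrc := contMDiffOn_mul hr (contMDiffOn_inv (contMDiffOn_sonicSq (γ := γ) hp1 hρ hρpos) hc2)
  have hrc' := contMDiffOn_mul (contMDiffOn_const (c := -(γ - 1))) hrc
  -- This is R_m without its div u term. It is C^1 because p is C^2, so the ordinary chain rule
  -- applies to it; only div u needs the streamline argument.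
  let q : ScalarField M := fun x => scalarD a b u p x * (γ * p x)⁻¹ +
    -(γ - 1) * (r x * (sonicSq γ p ρ x)⁻¹)
  have hq : ContMDiffOn IX 𝓘(ℝ, ℝ) 1 q (openSlab a b M) := hDp.add hrc'
  have hqz : scalarD a b u q z = scalarD a b u (fun x => scalarD a b u p x / (γ * p x)) z
      - (γ - 1) * scalarD a b u (fun x => r x / sonicSq γ p ρ x) z := by
    have h1 := scalarD_add u hDp hrc' hz
    rw [scalarD_const_mul u hrc _ hz] at h1
    simp only [div_eq_mul_inv]
    rw [h1]
    ring
  have hqd : HasDerivAt (fun t => q ((extChartAt IX z).symm (ξ t))) (scalarD a b u q z) 0 := by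
    have h1 := hasFDerivAt_scalarRep hq hz
    rw [scalarD_of_hasFDerivAt u hq hz h1, ← vecRep_self u z]
    rw [hξ0] at hξd
    have h2 := HasFDerivAt.comp_hasDerivAt_of_eq (0 : ℝ) h1 hξd hξ0.symm
    exact h2
  refine ⟨fun t => (extChartAt IX z).symm (ξ t), ?_, ?_, ?_, ?_⟩
  · simp only [hξ0, extChartAt_to_inv]
  · refine ContinuousAt.comp (g := (extChartAt IX z).symm) ?_ hξd.continuousAt
    rw [hξ0]
    exact continuousAt_extChartAt_symm z
  · simp only [extChartAt_symm_fst]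
    have h1 := (coordFun 0).hasFDerivAt.comp_hasDerivAt (0 : ℝ) hξd
    rw [hξ0, vecRep_self] at h1
    exact h1
  · have hsum := hqd.add hdiv
    refine (hsum.congr_of_eventuallyEq ?_).congr_deriv ?_
    · filter_upwards [hξo] with t ht
      have h1 := dvg_eq G hab hu ht.2 ((extChartAt IX z).map_target ht.1)
      rw [(extChartAt IX z).right_inv ht.1, divRep_eq G ht] at h1
      rw [resMass, h1]
      simp only [q, Pi.add_apply, div_eq_mul_inv]
      ring
    -- It remains to split div `F` into the divergences of the body force and of grad p/ρ.
    · have hgradrep : vecRep (fun x => (ρ x)⁻¹ • grad G p x) z =ᶠ[𝓝 (extChartAt IX z z)]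
          fun y => (ρ ((extChartAt IX z).symm y))⁻¹ • gradRep G p z y := by
        filter_upwards [(isOpen_coordOpenSlab z).mem_nhds hy] with y hy'
        have h1 := grad_eq G hp1 hy'.2 ((extChartAt IX z).map_target hy'.1)
        rw [(extChartAt IX z).right_inv hy'.1] at h1
        rw [vecRep_smul (fun x => (ρ x)⁻¹), ← h1]
        rfl
      have hgd := (hgrad.differentiableAt (by norm_num)).congr_of_eventuallyEq hgradrep
      have hfd := (contDiffAt_vecRep hf hz hzz).differentiableAt (by norm_num)
      have h2 := dvg_sub G hab hz hfd hgd
      rw [dvg_eq_fderiv G hab hz (hF.differentiableAt (by norm_num)) (by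
        filter_upwards [hgradrep] with y hy'
        rw [vecRep_sub, hy'])] at h2
      rw [h2, hqz, ← ricci_eq_fderiv G hz]
      simp only [← covDiff_eq_fderiv G hab hu hz]
      rw [pressureOp, contractDD]
      ring

end

section

variable {M : Type*} [TopologicalSpace M] [ChartedSpace (EuclideanSpace ℝ (Fin 2)) M]
  [IsManifold (𝓡 2) ∞ M] {a b : ℝ} (G : SlabMetric a b M)
  {γ k₀ cν : ℝ} {f : VField M} {r p ρ s : ScalarField M} {u : VField M}

/-! ### The residuals at the boundary -/

theorem tendsto_nhdsWithin_openSlab {M : Type*} [TopologicalSpace M] {h : ScalarField M} (hh : ContinuousOn h (slab a b M))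
    {z : ℝ × M} (hz : z ∈ slab a b M) :
    Filter.Tendsto h (𝓝[openSlab a b M] z) (𝓝 (h z)) :=
  (hh z hz).mono_left (nhdsWithin_mono z openSlab_subset_slab)

theorem tendsto_resEntropy (hab : a < b) (hr : ContinuousOn r (slab a b M))
    (hp : ContMDiffOn IX 𝓘(ℝ, ℝ) 1 p (slab a b M))
    (hρ : ContMDiffOn IX 𝓘(ℝ, ℝ) 1 ρ (slab a b M)) (hρpos : ∀ z ∈ slab a b M, 0 < ρ z)
    (hstate : ∀ z ∈ slab a b M, p z = entropyA k₀ cν s z * ρ z ^ γ)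
    (hu : ContMDiffOn IX IX.tangent 1 u.toBundle (slab a b M)) {z : ℝ × M} (hz : z ∈ slab a b M) :
    Filter.Tendsto (resEntropy a b γ k₀ cν r ρ s u) (𝓝[openSlab a b M] z)
      (𝓝 (resEntropy a b γ k₀ cν r ρ s u z)) := by
  refine (tendsto_scalarD hab (contMDiffOn_entropyA hp hρ hρpos hstate) hu.continuousOn hz).sub
    (tendsto_nhdsWithin_openSlab ?_ hz)
  exact (continuousOn_const.div (contMDiffOn_rpow hρ hρpos (γ - 1)).continuousOn
    fun z hz => (Real.rpow_pos_of_pos (hρpos z hz) _).ne').mul hr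

theorem tendsto_resBernoulli (hab : a < b) (hf : ContinuousOn f.toBundle (slab a b M))
    (hr : ContinuousOn r (slab a b M))
    (hp : ContMDiffOn IX 𝓘(ℝ, ℝ) 1 p (slab a b M))
    (hρ : ContMDiffOn IX 𝓘(ℝ, ℝ) 1 ρ (slab a b M)) (hρpos : ∀ z ∈ slab a b M, 0 < ρ z)
    (hu : ContMDiffOn IX IX.tangent 1 u.toBundle (slab a b M)) {z : ℝ × M} (hz : z ∈ slab a b M) :
    Filter.Tendsto (resBernoulli G γ f r p ρ u) (𝓝[openSlab a b M] z)
      (𝓝 (resBernoulli G γ f r p ρ u z)) := by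
  have : ContMDiffVectorBundle 0 EX (TangentSpace IX : ℝ × M → Type _) IX :=
    ContMDiffVectorBundle.of_le (n := 1) (by norm_num)
  refine ((tendsto_scalarD hab (contMDiffOn_bernoulli G hp hρ hρpos hu) hu.continuousOn hz).sub
    (tendsto_nhdsWithin_openSlab ?_ hz)).sub (tendsto_nhdsWithin_openSlab hr hz)
  exact (contMDiffOn_inner_section G (n := 0) (by norm_num) Subset.rfl (contMDiffOn_zero_iff.2 hf)
    (contMDiffOn_zero_iff.2 hu.continuousOn)).continuousOn

theorem tendsto_resMass (hab : a < b) (hγ : 1 < γ) (hr : ContinuousOn r (slab a b M))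
    (hp : ContMDiffOn IX 𝓘(ℝ, ℝ) 1 p (slab a b M)) (hppos : ∀ z ∈ slab a b M, 0 < p z)
    (hρ : ContMDiffOn IX 𝓘(ℝ, ℝ) 1 ρ (slab a b M)) (hρpos : ∀ z ∈ slab a b M, 0 < ρ z)
    (hu : ContMDiffOn IX IX.tangent 1 u.toBundle (slab a b M)) {z : ℝ × M} (hz : z ∈ slab a b M) :
    Filter.Tendsto (resMass G γ r p ρ u) (𝓝[openSlab a b M] z)
      (𝓝 (resMass G γ r p ρ u z)) := by
  have hγ0 : 0 < γ := by linarith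
  refine (((tendsto_scalarD hab hp hu.continuousOn hz).div (tendsto_nhdsWithin_openSlab
    (continuousOn_const.mul hp.continuousOn) hz) (mul_pos hγ0 (hppos z hz)).ne').add
      (tendsto_dvg G hab hu hz)).sub (tendsto_nhdsWithin_openSlab ?_ hz)
  exact (continuousOn_const.div (contMDiffOn_sonicSq hp hρ hρpos).continuousOn
    fun z hz => (div_pos (mul_pos hγ0 (hppos z hz)) (hρpos z hz)).ne').mul hr

/-- At a point of {b} × M the approach from the interior is `tendsto_resMass`, while along the slice
the residual is identically zero; together these give continuity. -/
theorem continuousOn_resMass (hab : a < b) (hγ : 1 < γ) (hr : ContinuousOn r (slab a b M))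
    (hp : ContMDiffOn IX 𝓘(ℝ, ℝ) 1 p (slab a b M)) (hppos : ∀ z ∈ slab a b M, 0 < p z)
    (hρ : ContMDiffOn IX 𝓘(ℝ, ℝ) 1 ρ (slab a b M)) (hρpos : ∀ z ∈ slab a b M, 0 < ρ z)
    (hu : ContMDiffOn IX IX.tangent 1 u.toBundle (slab a b M))
    (hb : ∀ x, resMass G γ r p ρ u (b, x) = 0) :
    ContinuousOn (resMass G γ r p ρ u) (Ioc a b ×ˢ univ) := by
  intro z hz
  have hzs : z ∈ slab a b M := ⟨⟨hz.1.1.le, hz.1.2⟩, trivial⟩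
  have ht := tendsto_resMass G hab hγ hr hp hppos hρ hρpos hu hzs
  rcases hz.1.2.lt_or_eq with h | h
  · have hzo : z ∈ openSlab a b M := ⟨⟨hz.1.1, h⟩, trivial⟩
    rw [isOpen_openSlab.nhdsWithin_eq hzo] at ht
    exact ContinuousAt.continuousWithinAt ht
  · have h0 : ∀ x : ℝ × M, x.1 = b → resMass G γ r p ρ u x = 0 := fun x hx =>
      (congrArg _ (Prod.ext hx rfl : x = (b, x.2))).trans (hb x.2)
    have hsub : Ioc a b ×ˢ (univ : Set M) ⊆ openSlab a b M ∪ {x | x.1 = b} := fun x hx => by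
      rcases hx.1.2.lt_or_eq with h' | h'
      · exact Or.inl ⟨⟨hx.1.1, h'⟩, trivial⟩
      · exact Or.inr h'
    refine ContinuousWithinAt.mono (ContinuousWithinAt.union ht ?_) hsub
    exact continuousWithinAt_const.congr (fun x hx => h0 x hx) (h0 z h)

end

end EulerSlab

end

/-! ### The equivalence of the two systems -/

theorem theorem2p1 {M : Type*} [TopologicalSpace M] [T2Space M] [CompactSpace M]
    [ChartedSpace (EuclideanSpace ℝ (Fin 2)) M] [IsManifold (𝓡 2) ∞ M]
    (a b : ℝ) (hab : a < b) (G : EulerSlab.SlabMetric a b M)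
    (γ k₀ cν : ℝ) (hγ : 1 < γ) (hk₀ : 0 < k₀) (hcν : 0 < cν)
    (f : EulerSlab.VField M)
    (hf : ContMDiffOn EulerSlab.IX EulerSlab.IX.tangent 1 f.toBundle (EulerSlab.openSlab a b M))
    (hf' : ContinuousOn f.toBundle (EulerSlab.slab a b M))
    (r : EulerSlab.ScalarField M)
    (hr : ContMDiffOn EulerSlab.IX 𝓘(ℝ, ℝ) 1 r (EulerSlab.openSlab a b M))
    (hr' : ContinuousOn r (EulerSlab.slab a b M))
    (L0 : ℝ × M → ℝ →L[ℝ] ℝ) (hL0 : ContinuousOn L0 (EulerSlab.slab a b M))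
    (L1 L2 : ℝ × M → ℝ → ℝ) (L3 : (z : ℝ × M) → TangentSpace EulerSlab.IX z → ℝ)
    (hL1 : ∀ z, L1 z 0 = 0) (hL2 : ∀ z, L2 z 0 = 0) (hL3 : ∀ z, L3 z 0 = 0)
    (K1 K2 : ℝ × M → ℝ → ℝ) (K3 : (z : ℝ × M) → TangentSpace EulerSlab.IX z → ℝ)
    (hK1 : ∀ z, K1 z 0 = 0) (hK2 : ∀ z, K2 z 0 = 0) (hK3 : ∀ z, K3 z 0 = 0)
    (p ρ s : EulerSlab.ScalarField M) (u : EulerSlab.VField M)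
    (hp : ContMDiffOn EulerSlab.IX 𝓘(ℝ, ℝ) 2 p (EulerSlab.openSlab a b M))
    (hp' : ContMDiffOn EulerSlab.IX 𝓘(ℝ, ℝ) 1 p (EulerSlab.slab a b M))
    (hρ : ContMDiffOn EulerSlab.IX 𝓘(ℝ, ℝ) 1 ρ (EulerSlab.slab a b M))
    (hu : ContMDiffOn EulerSlab.IX EulerSlab.IX.tangent 1 u.toBundle (EulerSlab.slab a b M))
    (hρpos : ∀ z ∈ EulerSlab.slab a b M, 0 < ρ z)
    (hstate : ∀ z ∈ EulerSlab.slab a b M, p z = EulerSlab.entropyA k₀ cν s z * ρ z ^ γ)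
    (hu0 : ∀ z ∈ EulerSlab.slab a b M, G.inner z (u z) (EulerSlab.pd z 0) ≠ 0) :
    EulerSlab.SolvesEuler G γ f r p ρ u ↔
      EulerSlab.SolvesDecomposed G γ k₀ cν f r L0 L1 L2 L3 K1 K2 K3 p ρ s u := by
  open EulerSlab in
  have hsub : openSlab a b M ⊆ slab a b M := openSlab_subset_slab
  have hppos := pressure_pos hk₀ hρpos hstate
  have hb : ∀ x : M, (b, x) ∈ slab a b M := fun x => ⟨⟨hab.le, le_rfl⟩, trivial⟩
  have hstream := fun hR {z} (hz : z ∈ openSlab a b M) => exists_streamline G hab hγ hf hr hp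
    (fun z hz => hppos z (hsub hz)) (hρ.mono hsub) (fun z hz => hρpos z (hsub hz)) (hu.mono hsub)
    hR hz
  rw [solvesEuler_iff G hab hγ hk₀ hp' hρ hρpos hstate hu]
  constructor
  · rintro ⟨hR, hA, hm⟩
    have hE : ∀ z ∈ openSlab a b M, resBernoulli G γ f r p ρ u z = 0 := fun z hz => by
      rw [resBernoulli_eq G hab hγ hp' hρ hρpos hstate hu hz, hR z hz, hA z hz, map_zero,
        zero_apply, mul_zero, add_zero]
    refine ⟨hA, hE, fun z hz => ?_, fun z hz α => ?_, fun x => ?_⟩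
    -- A streamline stays in the open slab for short times and R_m vanishes along it, so its
    -- derivative, the pressure expression, is zero.
    · have h0 : pressureOp G γ f r p ρ u z = 0 := by
        obtain ⟨X, hX0, hXc, -, hXm⟩ := hstream hR hz
        refine (hXm.congr_of_eventuallyEq (f₁ := fun _ => (0 : ℝ)) ?_).unique (hasDerivAt_const 0 0)
        have h1 : ∀ᶠ t in 𝓝 (0 : ℝ), X t ∈ openSlab a b M :=
          hXc.eventually (by rw [hX0]; exact isOpen_openSlab.mem_nhds hz)
        filter_upwards [h1] with t ht
        exact (hm _ ht).symm
      rw [h0, hm z hz, hE z hz, hA z hz, hR z hz, map_zero, hL1, hL2, hL3]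
      simp
    · rw [hR z hz, map_zero, zero_apply]
    -- The boundary functions are arbitrary away from zero, so the residuals must vanish exactly on
    -- the slice; they do, being limits of interior values.
    · rw [eq_zero_of_tendsto hab (hb x)
          (tendsto_resMass G hab hγ hr' hp' hppos hρ hρpos hu (hb x)) hm,
        eq_zero_of_tendsto hab (hb x)
          (tendsto_resBernoulli G hab hf' hr' hp' hρ hρpos hu (hb x)) hE,
        eq_zero_of_tendsto hab (hb x)
          (tendsto_resEntropy hab hr' hp' hρ hρpos hstate hu (hb x)) hA,
        resMomentum_eq_zero G hab hf' hp' hρ hρpos hu hR (hb x), hK1, hK2, hK3]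
      simp
  · rintro ⟨hA, hE, hP, hT, hB⟩
    have hR : ∀ z ∈ openSlab a b M, resMomentum G f p ρ u z = 0 := fun z hz => by
      -- The tangential equations are given; the missing condition G(R_u, u) = 0 is the Bernoulli
      -- residual once the entropy residual vanishes.
      refine eq_zero_of_inner G (hsub hz) (hT z hz) ?_ (hu0 z (hsub hz))
      have h1 := hE z hz
      rwa [resBernoulli_eq G hab hγ hp' hρ hρpos hstate hu hz, hA z hz, mul_zero, add_zero] at h1
    have hm1 : ∀ x, resMass G γ r p ρ u (b, x) = 0 := fun x => by
      have h1 := hB x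
      rwa [eq_zero_of_tendsto hab (hb x)
          (tendsto_resBernoulli G hab hf' hr' hp' hρ hρpos hu (hb x)) hE,
        eq_zero_of_tendsto hab (hb x)
          (tendsto_resEntropy hab hr' hp' hρ hρpos hstate hu (hb x)) hA,
        resMomentum_eq_zero G hab hf' hp' hρ hρpos hu hR (hb x), hK1, hK2, hK3, add_zero, add_zero,
        add_zero] at h1
    -- The pressure equation is now D_u R_m = −L⁰(R_m). A linear function on ℝ is multiplication by
    -- its value at 1, which gives the coefficient; the transversal speed is u⁰.
    refine ⟨hR, hA, eq_zero_of_transport (v := fun z => comp z 0 (u z)) (L := fun z => L0 z 1)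
      (continuousOn_resMass G hab hγ hr' hp' hppos hρ hρpos hu hm1) hm1
      (continuousOn_comp_zero hu.continuousOn) (fun z hz => ?_)
      (hL0.clm_apply continuousOn_const) fun z hz => ?_⟩
    · rw [← G.inner_pd_zero z hz]
      exact hu0 z hz
    · obtain ⟨X, hX0, hXc, hX1, hXm⟩ := hstream hR hz
      refine ⟨X, hX0, hXc, hX1, hXm.congr_deriv ?_⟩
      have h1 := hP z hz
      rw [hE z hz, hA z hz, hR z hz, hL1, hL2, hL3, add_zero, add_zero, add_zero] at h1
      have h2 : L0 z (resMass G γ r p ρ u z) = L0 z 1 * resMass G γ r p ρ u z := by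
        conv_lhs => rw [← mul_one (resMass G γ r p ρ u z), ← smul_eq_mul, map_smul, smul_eq_mul,
          mul_comm]
      rw [← h2]
      linarith
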